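/- Let $\Gamma=(X,R)$ be a finite, simple, connected graph with path-length distance $\partial$ and diameter $d\ge 3$ that is distance-regular: for all $h,i,j$ the number $p^h_{ij}=|\{z:\partial(x,z)=i,\ \partial(y,z)=j\}|$ is the same for all $x,y\in X$ with $\partial(x,y)=h$. Put $k=p^0_{11}$, $a_i=p^i_{1,i}$, $b_i=p^i_{1,i+1}$, $c_i=p^i_{1,i-1}$ (with $c_0=b_d=0$). Assume $\Gamma$ is not bipartite. Let $A_i$ be the $i$th distance matrix, $A=A_1$, and let $\theta_0>\theta_1>\cdots>\theta_d$ be the distinct eigenvalues of $A$. For an eigenvalue $\theta$ with primitive idempotent $E$ (the nonzero idempotent with $AE=\theta E$ in the real algebra generated by $A$) and $m=\operatorname{rank}E$, the *cosine sequence* $\sigma_0,\dots,\sigma_d$ of $\theta$ is defined by $E=|X|^{-1}m\sum_{i=0}^d\sigma_iA_i$; we write $\sigma=\sigma_1$. The graph $\Gamma$ is *tight* if it is not bipartite and $$\Bigl(\theta_1+\frac{k}{a_1+1}\Bigr)\Bigl(\theta_d+\frac{k}{a_1+1}\Bigr)=-\frac{ka_1b_1}{(a_1+1)^2}.$$ For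 tight $\Gamma$, the cosine sequence of $\theta$ is *feasible* if $\theta\in\{\theta_1,\theta_d\}$ and $\sigma_{i-1}\ne\sigma_{i+1}$ for $1\le i\le d-1$; the *auxiliary parameter* of $\theta\in\{\theta_1,\theta_d\}$ is $\dfrac{k^2-\theta\theta'}{k(\theta-\theta')}$, where $\theta'$ is the other element of $\{\theta_1,\theta_d\}$. **Theorem.** Let $\sigma_0,\sigma_1,\dots,\sigma_d,\varepsilon,h$ be complex scalars, and write $\sigma=\sigma_1$. The following are equivalent. (i) $\Gamma$ is tight, $\sigma_0,\dots,\sigma_d$ is a feasible cosine sequence for $\Gamma$, $\varepsilon$ is the associated auxiliary parameter, and $$h=\frac{(1-\sigma)(1-\sigma_2)}{(\sigma^2-\sigma_2)(1-\varepsilon\sigma)}.$$ (ii) $\sigma_0=1$, $\sigma_{d-1}=\sigma\sigma_d$, $\varepsilon\ne-1$, $$k=h\,\frac{\sigma-\varepsilon}{\sigma-1},\qquad c_d=h\,\frac{\sigma-\varepsilon}{\sigma-1},$$ $$b_i=h\,\frac{(\sigma_{i-1}-\sigma\sigma_i)(\sigma_{i+1}-\varepsilon\sigma_i)}{(\sigma_{i-1}-\sigma_{i+1})(\sigma_{i+1}-\sigma_i)},\qquad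 c_i=h\,\frac{(\sigma_{i+1}-\sigma\sigma_i)(\sigma_{i-1}-\varepsilon\sigma_i)}{(\sigma_{i+1}-\sigma_{i-1})(\sigma_{i-1}-\sigma_i)}\qquad(1\le i\le d-1),$$ and all denominators in these formulas for $k,c_d,b_i,c_i$ are nonzero. Consequently, the $d$ scalars $\sigma_1,\dots,\sigma_{d-1},\varepsilon$ determine the intersection numbers: if $\Gamma$ and $\Gamma'$ are tight distance-regular graphs of the same diameter $d\ge3$, having feasible cosine sequences that agree at the indices $1,\dots,d-1$ and whose associated auxiliary parameters are equal, then $\Gamma$ and $\Gamma'$ have the same $k$ and the same $a_i,b_i,c_i$ for $0\le i\le d$. -/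

import Mathlib

namespace SimpleGraph

variable {V : Type*} [Fintype V]

/-- The number of vertices `z` with `∂(x, z) = i` and `∂(y, z) = j`, i.e. `|Γ_i(x) ∩ Γ_j(y)|`. -/
noncomputable def sphereInterCard (G : SimpleGraph V) (i j : ℕ) (x y : V) : ℕ :=
  (Finset.univ.filter fun z => G.dist x z = i ∧ G.dist y z = j).card

/-- `G` is distance-regular: it is connected, and `|Γ_i(x) ∩ Γ_j(y)|` depends only on
`i`, `j` and the distance of `x` and `y`. -/
def IsDistanceRegular (G : SimpleGraph V) : Prop :=
  G.Connected ∧ ∀ (i j : ℕ) (x y x' y' : V), G.dist x y = G.dist x' y' →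
    G.sphereInterCard i j x y = G.sphereInterCard i j x' y'

open Classical in
/-- The intersection number `p^h_{ij}`: the value of `|Γ_i(x) ∩ Γ_j(y)|` at a pair `x, y` of
vertices at distance `h` (and `0` if there is no such pair). -/
noncomputable def intersectionNumber (G : SimpleGraph V) (h i j : ℕ) : ℕ :=
  if H : ∃ q : V × V, G.dist q.1 q.2 = h then
    G.sphereInterCard i j H.choose.1 H.choose.2
  else 0

/-- In a distance-regular graph, `p^h_{ij} = |Γ_i(x) ∩ Γ_j(y)|` for *all* `x, y` at distance `h`. -/
theorem IsDistanceRegular.intersectionNumber_eq {G : SimpleGraph V} (hG : G.IsDistanceRegular)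
    (i j : ℕ) (x y : V) :
    G.intersectionNumber (G.dist x y) i j = G.sphereInterCard i j x y := by
  have H : ∃ q : V × V, G.dist q.1 q.2 = G.dist x y := ⟨(x, y), rfl⟩
  unfold intersectionNumber
  rw [dif_pos H]
  exact hG.2 i j _ _ _ _ H.choose_spec

/-- The valency `k = p^0_{11}`. -/
noncomputable def drgK (G : SimpleGraph V) : ℕ := G.intersectionNumber 0 1 1

/-- `a_i = p^i_{1,i}`. -/
noncomputable def drgA (G : SimpleGraph V) (i : ℕ) : ℕ := G.intersectionNumber i 1 i

/-- `b_i = p^i_{1,i+1}`. -/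
noncomputable def drgB (G : SimpleGraph V) (i : ℕ) : ℕ := G.intersectionNumber i 1 (i + 1)

/-- `c_i = p^i_{1,i-1}` for `i ≥ 1`, and `c_0 = 0`. -/
noncomputable def drgC (G : SimpleGraph V) : ℕ → ℕ
  | 0 => 0
  | i + 1 => G.intersectionNumber (i + 1) 1 i

open Classical in
/-- The real adjacency matrix. -/
noncomputable def realAdj (G : SimpleGraph V) : Matrix V V ℝ := G.adjMatrix ℝ

/-- The `i`th distance matrix `A_i`, with complex entries. -/
noncomputable def distMatrix (G : SimpleGraph V) (i : ℕ) : Matrix V V ℂ :=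
  Matrix.of fun x y => if G.dist x y = i then 1 else 0

open Classical in
/-- `θ` is an eigenvalue of (the adjacency matrix of) `G`. -/
def IsEigenvalue (G : SimpleGraph V) (θ : ℝ) : Prop :=
  Module.End.HasEigenvalue (Matrix.toLin' G.realAdj) θ

/-- `θ` is the second largest among the distinct eigenvalues `θ_0 > θ_1 > ⋯ > θ_d`:
the greatest one among those that are not the largest. -/
def IsSecondLargestEigenvalue (G : SimpleGraph V) (θ : ℝ) : Prop :=
  IsGreatest {η : ℝ | G.IsEigenvalue η ∧ ∃ μ : ℝ, G.IsEigenvalue μ ∧ η < μ} θ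

/-- `θ` is the minimal eigenvalue `θ_d`. -/
def IsMinEigenvalue (G : SimpleGraph V) (θ : ℝ) : Prop :=
  IsLeast {η : ℝ | G.IsEigenvalue η} θ

open Classical in
/-- `E` is the primitive idempotent of `G` associated with `θ`: the nonzero idempotent `E` of the
Bose-Mesner algebra `M` (the subalgebra of `Mat_X(ℝ)` generated by the adjacency matrix `A`)
with `A E = θ E`. As `M` is generated by `A`, the last condition gives `M E = ℝ E`, so that `E` is
primitive, and there is exactly one such `E` for each eigenvalue `θ`. -/
def IsPrimitiveIdempotent (G : SimpleGraph V) (θ : ℝ) (E : Matrix V V ℝ) : Prop :=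
  E ∈ Algebra.adjoin ℝ {G.realAdj} ∧ E ≠ 0 ∧ E * E = E ∧ G.realAdj * E = θ • E

/-- The scalars `σ 0, …, σ d`, where `d` is the diameter, are the cosine sequence associated with
the eigenvalue `θ`: `E = |X|⁻¹ m ∑_{i=0}^d σ_i A_i`, where `E` is the primitive idempotent for `θ`
and `m = rank E`. (As `E` is real, so are these scalars. Values `σ i` with `i > d` play no role.) -/
def IsCosineSequence (G : SimpleGraph V) (θ : ℝ) (σ : ℕ → ℂ) : Prop :=
  ∃ E : Matrix V V ℝ, G.IsPrimitiveIdempotent θ E ∧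
    E.map (fun r : ℝ => (r : ℂ)) =
      ((Fintype.card V : ℂ)⁻¹ * (E.rank : ℂ)) •
        ∑ i ∈ Finset.range (G.diam + 1), σ i • G.distMatrix i

/-- `G` is tight: it is not bipartite, and equality holds in the Fundamental Bound
`(θ_1 + k/(a_1+1)) (θ_d + k/(a_1+1)) ≥ - k a_1 b_1 / (a_1+1)²`. -/
def IsTight (G : SimpleGraph V) : Prop :=
  ¬ G.IsBipartite ∧ ∃ θ₁ θd : ℝ, G.IsSecondLargestEigenvalue θ₁ ∧ G.IsMinEigenvalue θd ∧
    (θ₁ + (G.drgK : ℝ) / ((G.drgA 1 : ℝ) + 1)) * (θd + (G.drgK : ℝ) / ((G.drgA 1 : ℝ) + 1)) =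
      - ((G.drgK : ℝ) * (G.drgA 1 : ℝ) * (G.drgB 1 : ℝ)) / ((G.drgA 1 : ℝ) + 1) ^ 2

/-- `θ` is one of `θ_1, θ_d`, and `θ'` is its complement in `{θ_1, θ_d}`. -/
def AreComplementary (G : SimpleGraph V) (θ θ' : ℝ) : Prop :=
  (G.IsSecondLargestEigenvalue θ ∧ G.IsMinEigenvalue θ') ∨
    (G.IsMinEigenvalue θ ∧ G.IsSecondLargestEigenvalue θ')

/-- `ε` is the auxiliary parameter associated with `θ ∈ {θ_1, θ_d}`:
`ε = (k² - θ θ') / (k (θ - θ'))`, where `θ'` is the complement of `θ` in `{θ_1, θ_d}`. -/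
def IsAuxiliaryParameter (G : SimpleGraph V) (θ : ℝ) (ε : ℂ) : Prop :=
  ∃ θ' : ℝ, G.AreComplementary θ θ' ∧
    ε = (((G.drgK : ℝ) ^ 2 - θ * θ') / ((G.drgK : ℝ) * (θ - θ')) : ℝ)

/-- `σ 0, …, σ d` is a feasible cosine sequence, with associated eigenvalue `θ`: `θ` is one of
`θ_1, θ_d`, and `σ_{i-1} ≠ σ_{i+1}` for `1 ≤ i ≤ d - 1`. -/
def IsFeasibleCosineSequence (G : SimpleGraph V) (θ : ℝ) (σ : ℕ → ℂ) : Prop :=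
  G.IsCosineSequence θ σ ∧ (G.IsSecondLargestEigenvalue θ ∨ G.IsMinEigenvalue θ) ∧
    ∀ i : ℕ, 1 ≤ i → i < G.diam → σ (i - 1) ≠ σ (i + 1)

/-- `G` is tight, `σ 0, …, σ d` is a feasible cosine sequence for `G`, and `ε` is the
associated auxiliary parameter. -/
def IsTightWith (G : SimpleGraph V) (σ : ℕ → ℂ) (ε : ℂ) : Prop :=
  G.IsTight ∧ ∃ θ : ℝ, G.IsFeasibleCosineSequence θ σ ∧ G.IsAuxiliaryParameter θ ε

end SimpleGraph

namespace SimpleGraph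

/-! ### Intersection numbers and the three-term recurrence. -/

section DistanceRegular

variable {V : Type*} [Fintype V] {G : SimpleGraph V}

namespace IsDistanceRegular

/-! A cosine sequence is the same thing as a solution of c_i f_{i-1} + a_i f_i + b_i f_{i+1} = θ f_i
with f_0 = 1 (`isCosineSequence_iff`). The theorem thereby becomes a statement about two solutions:
σ for θ and ρ for the complementary eigenvalue.

The matrix with entries σ(∂(x,y)) is positive semidefinite. For an edge xy, Cauchy–Schwarz applied
to the images of x + y and of the common neighbourhood of x, y bounds the number of arcs inside that
neighbourhood, from below for an eigenvalue in (-1, k) and from above for one less than -1.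
Eliminating this number gives the Fundamental Bound, and tightness means equality at every edge for
both eigenvalues (`fundamental_bound`). Equality is a linear dependence, which may be tested at any
vertex z. If z is at distances i and i+1 from the ends of the edge, the same unknown count occurs in
the identities for σ and ρ, and eliminating it gives σ_{i+1}ρ_{i+1} - σ_iρ_i = ε(σ_iρ_{i+1} -
ρ_iσ_{i+1}) (`auxiliary_eq`). If z is at distance d from both ends, the result is a_d = 0
(`drgA_diam`).

Thus σ and ε determine ρ, and the recurrences of σ and ρ at i are two linear equations for b_i and
c_i (`solve_recurrences`). Their solution is the parametrization, with h fixed by c_1 = 1.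

Conversely, ρ is defined as the product forced by the relation above. The formulas make σ and ρ
solve the recurrence (`recurrences_of_parametrization`), the relation at i = 1 gives equality in the
Fundamental Bound (`tight_of_cosines`), and only θ_1, θ_d can attain it (`extremal_of_tight`). For
the last claim, σ_d is recovered from σ_{d-1} = σσ_d, since σ ≠ 0 when d ≥ 3. -/

theorem dist_le_diam (hG : G.IsDistanceRegular) (x y : V) : G.dist x y ≤ G.diam := by
  have := hG.1.nonempty
  exact SimpleGraph.dist_le_diam (connected_iff_ediam_ne_top.1 hG.1)

theorem exists_dist_eq_and_dist_eq (hG : G.IsDistanceRegular) (x y : V) {i : ℕ}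
    (hi : i ≤ G.dist x y) : ∃ z, G.dist x z = i ∧ G.dist z y = G.dist x y - i := by
  obtain ⟨p, hp⟩ := hG.1.exists_walk_length_eq_dist x y
  refine ⟨p.getVert i, ?_⟩
  have h1 := dist_le (p.take i)
  have h2 := dist_le (p.drop i)
  have h3 := hG.1.dist_triangle (u := x) (v := p.getVert i) (w := y)
  rw [Walk.take_length] at h1
  rw [Walk.drop_length] at h2
  omega

theorem exists_dist_eq (hG : G.IsDistanceRegular) {i : ℕ} (hi : i ≤ G.diam) :
    ∃ x y : V, G.dist x y = i := by
  have := hG.1.nonempty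
  obtain ⟨x, y, hxy⟩ := G.exists_dist_eq_diam
  obtain ⟨z, hz, -⟩ := hG.exists_dist_eq_and_dist_eq x y (i := i) (by omega)
  exact ⟨x, z, hz⟩

theorem exists_adj_dist_eq (hG : G.IsDistanceRegular) {i : ℕ} (hi : i + 1 ≤ G.diam) :
    ∃ x y z : V, G.Adj x y ∧ G.dist x z = i ∧ G.dist y z = i + 1 := by
  obtain ⟨y, z, hyz⟩ := hG.exists_dist_eq hi
  obtain ⟨x, h1, h2⟩ := hG.exists_dist_eq_and_dist_eq y z (i := 1) (by omega)
  exact ⟨x, y, z, (dist_eq_one_iff_adj.1 h1).symm, by omega, hyz⟩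

theorem card_filter_adj (hG : G.IsDistanceRegular) (x y : V) (j : ℕ) [DecidablePred (G.Adj x)] :
    (Finset.univ.filter fun z => G.Adj x z ∧ G.dist y z = j).card =
      G.intersectionNumber (G.dist x y) 1 j := by
  rw [hG.intersectionNumber_eq, sphereInterCard]
  congr 1
  ext z
  simp [dist_eq_one_iff_adj]

theorem dist_adj_cases (hG : G.IsDistanceRegular) {x z : V} (h : G.Adj x z) (y : V) :
    G.dist y z + 1 = G.dist x y ∨ G.dist y z = G.dist x y ∨ G.dist y z = G.dist x y + 1 := by
  have h1 := hG.1.dist_triangle (u := y) (v := x) (w := z)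
  have h2 := hG.1.dist_triangle (u := y) (v := z) (w := x)
  have h3 := dist_eq_one_iff_adj.2 h
  have h4 := dist_eq_one_iff_adj.2 h.symm
  have h5 := G.dist_comm (u := x) (v := y)
  omega

open Classical in
-- Neighbours of x lie at distance i-1, i or i+1 from y, where i = ∂(x,y). At i = 0 the truncated
-- index `0 - 1 = 0` is harmless because c_0 = 0.
theorem sum_adj_dist (hG : G.IsDistanceRegular) {R : Type*} [CommRing R] (x y : V) (f : ℕ → R) :
    (∑ z, if G.Adj x z then f (G.dist y z) else 0) =
      (G.drgC (G.dist x y) : R) * f (G.dist x y - 1) + (G.drgA (G.dist x y) : R) * f (G.dist x y) +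
        (G.drgB (G.dist x y) : R) * f (G.dist x y + 1) := by
  have hB := hG.card_filter_adj x y (G.dist x y + 1)
  have hA := hG.card_filter_adj x y (G.dist x y)
  have hC : (Finset.univ.filter fun z => G.Adj x z ∧ G.dist y z + 1 = G.dist x y).card =
      G.drgC (G.dist x y) := by
    rcases Nat.eq_zero_or_pos (G.dist x y) with h | h
    · rw [h]; simp [drgC]
    · have := hG.card_filter_adj x y (G.dist x y - 1)
      obtain ⟨i, hi⟩ : ∃ i, G.dist x y = i + 1 := ⟨G.dist x y - 1, by omega⟩
      rw [hi] at this ⊢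
      simpa [drgC] using this
  have key : ∀ z, (if G.Adj x z then f (G.dist y z) else 0) =
      (if G.Adj x z ∧ G.dist y z + 1 = G.dist x y then f (G.dist x y - 1) else 0) +
      (if G.Adj x z ∧ G.dist y z = G.dist x y then f (G.dist x y) else 0) +
      (if G.Adj x z ∧ G.dist y z = G.dist x y + 1 then f (G.dist x y + 1) else 0) := by
    intro z
    by_cases h : G.Adj x z
    · rcases hG.dist_adj_cases h y with h1 | h1 | h1
      · have : G.dist x y - 1 = G.dist y z := by omega
        rw [this, ← h1]; simp [h, add_assoc]
      · simp [h, h1]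
      · simp [h, h1, add_assoc]
    · simp [h]
  simp_rw [key, Finset.sum_add_distrib, ← Finset.sum_filter, Finset.sum_const, nsmul_eq_mul]
  rw [hA, hB, hC]
  rfl

open Classical in
theorem card_neighbors (hG : G.IsDistanceRegular) (x : V) :
    (Finset.univ.filter fun z => G.Adj x z).card = G.drgK := by
  have := hG.card_filter_adj x x 1
  rw [dist_self] at this
  rw [drgK, ← this]
  congr 1
  ext z
  simp only [Finset.mem_filter, Finset.mem_univ, true_and]
  exact ⟨fun h => ⟨h, dist_eq_one_iff_adj.2 h⟩, fun h => h.1⟩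

theorem drgC_add_drgA_add_drgB (hG : G.IsDistanceRegular) {i : ℕ} (hi : i ≤ G.diam) :
    G.drgC i + G.drgA i + G.drgB i = G.drgK := by
  classical
  obtain ⟨x, y, rfl⟩ := hG.exists_dist_eq hi
  have := hG.sum_adj_dist (R := ℤ) x y (fun _ => 1)
  rw [← Finset.sum_filter, Finset.sum_const, hG.card_neighbors x] at this
  simp only [nsmul_eq_mul, mul_one] at this
  exact_mod_cast this.symm

theorem drgA_zero (hG : G.IsDistanceRegular) : G.drgA 0 = 0 := by
  classical
  have := hG.1.nonempty
  obtain ⟨x⟩ := this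
  have := hG.card_filter_adj x x 0
  rw [dist_self] at this
  rw [drgA, ← this, Finset.card_eq_zero, Finset.filter_eq_empty_iff]
  rintro z - ⟨h1, h2⟩
  rw [dist_eq_one_iff_adj.2 h1] at h2
  omega

theorem drgB_zero (hG : G.IsDistanceRegular) : G.drgB 0 = G.drgK := by
  have := hG.drgC_add_drgA_add_drgB (i := 0) (Nat.zero_le _)
  rw [hG.drgA_zero] at this
  simpa [drgC] using this

theorem drgC_one (hG : G.IsDistanceRegular) (hd : 1 ≤ G.diam) : G.drgC 1 = 1 := by
  classical
  obtain ⟨x, y, h⟩ := hG.exists_dist_eq hd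
  have := hG.card_filter_adj x y 0
  rw [h] at this
  rw [drgC, ← this, Finset.card_eq_one]
  refine ⟨y, ?_⟩
  ext z
  simp only [Finset.mem_filter, Finset.mem_univ, true_and, Finset.mem_singleton,
    hG.1.dist_eq_zero_iff]
  exact ⟨fun h => h.2.symm, fun h' => ⟨h' ▸ dist_eq_one_iff_adj.1 h, h'.symm⟩⟩

theorem drgC_pos (hG : G.IsDistanceRegular) {i : ℕ} (hi : i + 1 ≤ G.diam) :
    0 < G.drgC (i + 1) := by
  classical
  obtain ⟨x, y, z, hxy, hx, hy⟩ := hG.exists_adj_dist_eq hi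
  have := hG.card_filter_adj y z i
  rw [hy] at this
  rw [drgC, ← this, Finset.card_pos]
  exact ⟨x, by simp [hxy.symm, dist_comm, hx]⟩

theorem drgB_pos (hG : G.IsDistanceRegular) {i : ℕ} (hi : i < G.diam) : 0 < G.drgB i := by
  classical
  obtain ⟨x, y, z, hxy, hx, hy⟩ := hG.exists_adj_dist_eq hi
  have := hG.card_filter_adj x z (i + 1)
  rw [hx] at this
  rw [drgB, ← this, Finset.card_pos]
  exact ⟨y, by simp [hxy, dist_comm, hy]⟩

theorem drgB_diam (hG : G.IsDistanceRegular) : G.drgB G.diam = 0 := by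
  classical
  obtain ⟨x, y, h⟩ := hG.exists_dist_eq le_rfl
  have := hG.card_filter_adj x y (G.diam + 1)
  rw [h] at this
  rw [drgB, ← this, Finset.card_eq_zero, Finset.filter_eq_empty_iff]
  rintro z - ⟨-, h2⟩
  have := hG.dist_le_diam y z
  omega

theorem exists_adj_dist_eq_diam (hG : G.IsDistanceRegular) (ha : G.drgA G.diam ≠ 0) :
    ∃ x y z : V, G.Adj x y ∧ G.dist x z = G.diam ∧ G.dist y z = G.diam := by
  classical
  obtain ⟨x, z, h⟩ := hG.exists_dist_eq le_rfl
  have := hG.card_filter_adj x z G.diam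
  rw [h] at this
  rw [drgA, ← this, ← Nat.pos_iff_ne_zero, Finset.card_pos] at ha
  obtain ⟨y, hy⟩ := ha
  simp only [Finset.mem_filter, Finset.mem_univ, true_and] at hy
  exact ⟨x, y, z, hy.1, h, by rw [dist_comm]; exact hy.2⟩

end IsDistanceRegular

/-- `f 0, …, f d` satisfies the three-term recurrence
`c_i f_{i-1} + a_i f_i + b_i f_{i+1} = θ f_i` for `0 ≤ i ≤ d`. -/
def IsEigenSequence (G : SimpleGraph V) {R : Type*} [CommRing R] (θ : R) (f : ℕ → R) : Prop :=
  ∀ i ≤ G.diam, (G.drgC i : R) * f (i - 1) + (G.drgA i : R) * f i + (G.drgB i : R) * f (i + 1) =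
    θ * f i

namespace IsEigenSequence

variable {K : Type*} [Field K] [CharZero K] {θ : K} {f : ℕ → K}

/-- Since b_i ≠ 0 for i < d, the recurrence determines f forwards from f_0. -/
theorem eq_zero (hG : G.IsDistanceRegular) (h : G.IsEigenSequence θ f) (h0 : f 0 = 0) :
    ∀ i ≤ G.diam, f i = 0 := by
  intro i
  induction i using Nat.strong_induction_on with
  | _ i ih =>
    intro hi
    rcases i with _ | i
    · exact h0
    have h1 := h i (by omega)
    rw [ih i (by omega) (by omega), ih (i - 1) (by omega) (by omega)] at h1
    have := (hG.drgB_pos (i := i) (by omega)).ne'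
    simpa [this] using h1

/-- Since c_i ≠ 0 for i ≥ 1, the recurrence also runs backwards. -/
theorem eq_zero_of_consecutive (hG : G.IsDistanceRegular) (h : G.IsEigenSequence θ f) :
    ∀ i, i + 1 ≤ G.diam → f i = 0 → f (i + 1) = 0 → f 0 = 0 := by
  intro i
  induction i with
  | zero => exact fun _ h _ => h
  | succ i ih =>
    intro hi h0 h1
    refine ih (by omega) ?_ h0
    have h2 := h (i + 1) (by omega)
    rw [h0, h1] at h2
    have := (hG.drgC_pos (i := i) (by omega)).ne'
    simpa [this] using h2

theorem ne_zero_or (hG : G.IsDistanceRegular) (h : G.IsEigenSequence θ f) (h0 : f 0 = 1) {i : ℕ}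
    (hi : i + 1 ≤ G.diam) : ¬ (f i = 0 ∧ f (i + 1) = 0) := fun h' => by
  simpa [h0] using h.eq_zero_of_consecutive hG i hi h'.1 h'.2

theorem eq_mul (hG : G.IsDistanceRegular) (h : G.IsEigenSequence θ f) {g : ℕ → K}
    (hg : G.IsEigenSequence θ g) (hg0 : g 0 = 1) : ∀ i ≤ G.diam, f i = f 0 * g i := by
  intro i hi
  refine sub_eq_zero.1 (eq_zero hG (θ := θ) (f := fun i => f i - f 0 * g i) ?_ (by simp [hg0]) i hi)
  intro i hi
  linear_combination h i hi - f 0 * hg i hi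

theorem eigenvalue_eq (hG : G.IsDistanceRegular) (h : G.IsEigenSequence θ f) (h0 : f 0 = 1) :
    θ = (G.drgK : K) * f 1 := by
  have := h 0 (Nat.zero_le _)
  simpa [drgC, hG.drgA_zero, hG.drgB_zero, h0] using this.symm

end IsEigenSequence

end DistanceRegular

/-! ### Bose–Mesner algebra, positivity and eigenvalue bounds. -/

section Spectrum

open Matrix
open scoped Classical

variable {V : Type*} {G : SimpleGraph V}

/-- The matrix whose `(x, y)` entry is `f (∂(x, y))`, i.e. `∑ i, f i • A_i`. -/
noncomputable def radialMatrix (G : SimpleGraph V) (f : ℕ → ℝ) : Matrix V V ℝ :=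
  Matrix.of fun x y => f (G.dist x y)

@[simp]
theorem radialMatrix_apply (f : ℕ → ℝ) (x y : V) : G.radialMatrix f x y = f (G.dist x y) := rfl

theorem radialMatrix_transpose (f : ℕ → ℝ) : (G.radialMatrix f)ᵀ = G.radialMatrix f := by
  ext x y
  simp [dist_comm]

theorem realAdj_apply (x y : V) : G.realAdj x y = if G.Adj x y then 1 else 0 := by
  simp [realAdj, adjMatrix_apply]

theorem realAdj_transpose : (G.realAdj)ᵀ = G.realAdj := by
  ext x y
  simp [realAdj_apply, adj_comm]

theorem realAdj_eq_radialMatrix : G.realAdj = G.radialMatrix fun i => if i = 1 then 1 else 0 := by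
  ext x y
  simp [realAdj_apply, dist_eq_one_iff_adj]

variable [Fintype V]

theorem one_eq_radialMatrix (hG : G.IsDistanceRegular) :
    (1 : Matrix V V ℝ) = G.radialMatrix fun i => if i = 0 then 1 else 0 := by
  ext x y
  simp [Matrix.one_apply, hG.1.dist_eq_zero_iff]

namespace IsDistanceRegular

theorem realAdj_mul_radialMatrix (hG : G.IsDistanceRegular) (f : ℕ → ℝ) :
    G.realAdj * G.radialMatrix f = G.radialMatrix fun i =>
      (G.drgC i : ℝ) * f (i - 1) + (G.drgA i : ℝ) * f i + (G.drgB i : ℝ) * f (i + 1) := by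
  ext x y
  rw [radialMatrix_apply, ← hG.sum_adj_dist x y f, Matrix.mul_apply]
  refine Finset.sum_congr rfl fun z _ => ?_
  rw [realAdj_apply, radialMatrix_apply, dist_comm]
  split_ifs <;> simp

theorem exists_aeval_eq_radialMatrix (hG : G.IsDistanceRegular) (p : Polynomial ℝ) :
    ∃ f, Polynomial.aeval G.realAdj p = G.radialMatrix f := by
  induction p using Polynomial.induction_on' with
  | add p q hp hq =>
    obtain ⟨f, hf⟩ := hp
    obtain ⟨g, hg⟩ := hq
    refine ⟨fun i => f i + g i, ?_⟩
    rw [map_add, hf, hg]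
    rfl
  | monomial n a =>
    suffices ∃ f, G.realAdj ^ n = G.radialMatrix f by
      obtain ⟨f, hf⟩ := this
      refine ⟨fun i => a * f i, ?_⟩
      rw [Polynomial.aeval_monomial, hf, ← Algebra.smul_def]
      rfl
    induction n with
    | zero => exact ⟨_, by rw [pow_zero, one_eq_radialMatrix hG]⟩
    | succ n ih =>
      obtain ⟨f, hf⟩ := ih
      exact ⟨_, by rw [pow_succ', hf, hG.realAdj_mul_radialMatrix]⟩

theorem radialMatrix_congr (hG : G.IsDistanceRegular) {f g : ℕ → ℝ}
    (h : ∀ i ≤ G.diam, f i = g i) : G.radialMatrix f = G.radialMatrix g := by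
  ext x y
  exact h _ (hG.dist_le_diam x y)

theorem isEigenSequence_iff (hG : G.IsDistanceRegular) {θ : ℝ} {f : ℕ → ℝ} :
    G.IsEigenSequence θ f ↔ G.realAdj * G.radialMatrix f = θ • G.radialMatrix f := by
  rw [hG.realAdj_mul_radialMatrix]
  refine ⟨fun h => ?_, fun h i hi => ?_⟩
  · ext x y
    exact h _ (hG.dist_le_diam x y)
  · obtain ⟨x, y, rfl⟩ := hG.exists_dist_eq hi
    exact congrFun (congrFun h x) y

theorem isEigenvalue_of_isEigenSequence (hG : G.IsDistanceRegular) {θ : ℝ} {f : ℕ → ℝ}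
    (h : G.IsEigenSequence θ f) (h0 : f 0 = 1) : G.IsEigenvalue θ := by
  obtain ⟨x⟩ := hG.1.nonempty
  refine Module.End.hasEigenvalue_of_hasEigenvector (x := fun y => f (G.dist y x))
    ⟨Module.End.mem_eigenspace_iff.2 ?_, fun h' => ?_⟩
  · have := hG.isEigenSequence_iff.1 h
    ext y
    have := congrFun (congrFun this y) x
    simpa [Matrix.toLin'_apply, Matrix.mulVec, dotProduct, Matrix.mul_apply] using this
  · have := congrFun h' x
    simp [h0] at this

/-- Write the minimal polynomial of A as (X - θ)q. Then q(A) ≠ 0 by degree and (A - θ)q(A) = 0, so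
the entries of q(A), as a function of distance, solve the recurrence. The value at 0 is nonzero,
hence can be normalized. -/
theorem exists_isEigenSequence (hG : G.IsDistanceRegular) {θ : ℝ} (h : G.IsEigenvalue θ) :
    ∃ f : ℕ → ℝ, f 0 = 1 ∧ G.IsEigenSequence θ f ∧
      ∃ q : Polynomial ℝ, Polynomial.aeval G.realAdj q = G.radialMatrix f := by
  have hroot : (minpoly ℝ G.realAdj).IsRoot θ := by
    rw [← Matrix.minpoly_toLin']
    exact Module.End.hasEigenvalue_iff_isRoot.1 h
  obtain ⟨q, hq⟩ := Polynomial.dvd_iff_isRoot.2 hroot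
  obtain ⟨f, hf⟩ := hG.exists_aeval_eq_radialMatrix q
  have hint : IsIntegral ℝ G.realAdj := Algebra.IsIntegral.isIntegral _
  have hmin := minpoly.ne_zero hint
  have hq0 : q ≠ 0 := by
    rintro rfl
    exact hmin (by simpa using hq)
  have hne : Polynomial.aeval G.realAdj q ≠ 0 := by
    intro h0
    have h1 := Polynomial.natDegree_le_of_dvd (minpoly.dvd ℝ _ h0) hq0
    rw [hq, Polynomial.natDegree_mul (Polynomial.X_sub_C_ne_zero θ) hq0,
      Polynomial.natDegree_X_sub_C] at h1
    omega
  have heig : G.IsEigenSequence θ f := by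
    rw [hG.isEigenSequence_iff, ← hf]
    have h1 := minpoly.aeval ℝ G.realAdj
    rw [hq, map_mul, map_sub, Polynomial.aeval_X, Polynomial.aeval_C, sub_mul,
      ← Algebra.smul_def] at h1
    exact sub_eq_zero.1 h1
  have hf0 : f 0 ≠ 0 := by
    intro h0
    refine hne ?_
    rw [hf, hG.radialMatrix_congr (g := 0) (heig.eq_zero hG h0)]
    rfl
  refine ⟨fun i => (f 0)⁻¹ * f i, inv_mul_cancel₀ hf0, ?_, Polynomial.C (f 0)⁻¹ * q, ?_⟩
  · intro i hi
    linear_combination (f 0)⁻¹ * heig i hi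
  · rw [map_mul, hf, Polynomial.aeval_C, ← Algebra.smul_def]
    rfl

theorem exists_aeval_eq (hG : G.IsDistanceRegular) {θ : ℝ} {f : ℕ → ℝ}
    (h : G.IsEigenSequence θ f) (h0 : f 0 = 1) :
    ∃ q : Polynomial ℝ, Polynomial.aeval G.realAdj q = G.radialMatrix f := by
  obtain ⟨g, hg0, hg, q, hq⟩ := hG.exists_isEigenSequence (hG.isEigenvalue_of_isEigenSequence h h0)
  refine ⟨q, hq.trans (hG.radialMatrix_congr fun i hi => ?_)⟩
  simpa [hg0] using hg.eq_mul hG h h0 i hi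

/-- The matrix M of f is q(A) for some q, and AM = θM, so M² = q(θ)M. A diagonal entry of this
identity shows that q(θ) is a sum of squares, one of them 1. -/
theorem exists_radialMatrix_mul_self (hG : G.IsDistanceRegular) {θ : ℝ} {f : ℕ → ℝ}
    (h : G.IsEigenSequence θ f) (h0 : f 0 = 1) :
    ∃ s : ℝ, 0 < s ∧ G.radialMatrix f * G.radialMatrix f = s • G.radialMatrix f := by
  obtain ⟨q, hq⟩ := hG.exists_aeval_eq h h0
  have hA := hG.isEigenSequence_iff.1 h
  have key : ∀ p : Polynomial ℝ, Polynomial.aeval G.realAdj p * G.radialMatrix f =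
      p.eval θ • G.radialMatrix f := by
    intro p
    induction p using Polynomial.induction_on' with
    | add p q hp hq => rw [map_add, add_mul, hp, hq, Polynomial.eval_add, add_smul]
    | monomial n a =>
      have hn : G.realAdj ^ n * G.radialMatrix f = θ ^ n • G.radialMatrix f := by
        induction n with
        | zero => simp
        | succ n ih => rw [pow_succ, mul_assoc, hA, mul_smul_comm, ih, smul_smul, pow_succ']
      rw [Polynomial.aeval_monomial, Polynomial.eval_monomial, mul_assoc, hn, ← Algebra.smul_def,
        smul_smul]
  refine ⟨q.eval θ, ?_, by rw [← key, hq]⟩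
  have h1 := key q
  rw [hq] at h1
  obtain ⟨x⟩ := hG.1.nonempty
  have h2 := congrFun (congrFun h1 x) x
  simp only [Matrix.mul_apply, radialMatrix_apply, Matrix.smul_apply, dist_self, h0, smul_eq_mul,
    mul_one] at h2
  rw [← h2]
  refine Finset.sum_pos' (fun y _ => ?_) ⟨x, Finset.mem_univ _, by simp [h0]⟩
  rw [G.dist_comm (u := y)]
  exact mul_self_nonneg _

/-- The quadratic form of `radialMatrix σ` is positive semidefinite for a cosine sequence `σ`. -/
theorem dotProduct_radialMatrix (hG : G.IsDistanceRegular) {θ : ℝ} {f : ℕ → ℝ}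
    (h : G.IsEigenSequence θ f) (h0 : f 0 = 1) (u : V → ℝ) :
    0 ≤ u ⬝ᵥ (G.radialMatrix f *ᵥ u) ∧
      (u ⬝ᵥ (G.radialMatrix f *ᵥ u) = 0 → G.radialMatrix f *ᵥ u = 0) := by
  obtain ⟨s, hs, hM⟩ := hG.exists_radialMatrix_mul_self h h0
  have key : (G.radialMatrix f *ᵥ u) ⬝ᵥ (G.radialMatrix f *ᵥ u) =
      s * (u ⬝ᵥ (G.radialMatrix f *ᵥ u)) := by
    rw [Matrix.dotProduct_mulVec, ← Matrix.mulVec_transpose, radialMatrix_transpose,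
      Matrix.mulVec_mulVec, hM, Matrix.smul_mulVec, smul_dotProduct, smul_eq_mul, dotProduct_comm]
  have hnn : 0 ≤ (G.radialMatrix f *ᵥ u) ⬝ᵥ (G.radialMatrix f *ᵥ u) :=
    Finset.sum_nonneg fun i _ => mul_self_nonneg _
  rw [key] at hnn
  refine ⟨nonneg_of_mul_nonneg_right hnn hs, fun h' => ?_⟩
  rw [h', mul_zero] at key
  exact dotProduct_self_eq_zero.1 key

theorem abs_cosine_le_one (hG : G.IsDistanceRegular) {θ : ℝ} {f : ℕ → ℝ}
    (h : G.IsEigenSequence θ f) (h0 : f 0 = 1) {x y : V} :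
    -1 ≤ f (G.dist x y) ∧ f (G.dist x y) ≤ 1 := by
  have h1 := (hG.dotProduct_radialMatrix h h0 (Pi.single x 1 + Pi.single y 1)).1
  have h2 := (hG.dotProduct_radialMatrix h h0 (Pi.single x 1 - Pi.single y 1)).1
  simp [Matrix.mulVec_add, Matrix.mulVec_sub, add_dotProduct, sub_dotProduct, h0,
    G.dist_comm (u := y)] at h1 h2
  constructor <;> linarith

/-- The vector e_x + e_y is isotropic for a positive semidefinite form, hence lies in its kernel. -/
theorem cosine_eq_neg (hG : G.IsDistanceRegular) {θ : ℝ} {f : ℕ → ℝ}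
    (h : G.IsEigenSequence θ f) (h0 : f 0 = 1) {x y : V} (hxy : f (G.dist x y) = -1) (z : V) :
    f (G.dist z y) = - f (G.dist z x) := by
  have h1 := (hG.dotProduct_radialMatrix h h0 (Pi.single x 1 + Pi.single y 1)).2 (by
    simp [Matrix.mulVec_add, add_dotProduct, h0, G.dist_comm (u := y), hxy])
  have h2 := congrFun h1 z
  simp [Matrix.mulVec_add] at h2
  linarith

/-- If f_1 = -1, then f(∂(x,·)) changes sign along every edge and never vanishes, so its sign is a
proper 2-colouring. -/
theorem neg_one_lt_cosine_one (hG : G.IsDistanceRegular) (hnb : ¬ G.IsBipartite)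
    (hd : 1 ≤ G.diam) {θ : ℝ} {f : ℕ → ℝ} (h : G.IsEigenSequence θ f) (h0 : f 0 = 1) :
    -1 < f 1 := by
  obtain ⟨x, y, hxy⟩ := hG.exists_dist_eq hd
  refine lt_of_le_of_ne (hxy ▸ (hG.abs_cosine_le_one h h0).1) fun h1 => hnb ?_
  have hadj : ∀ y z, G.Adj y z → f (G.dist x z) = - f (G.dist x y) := fun y z hyz =>
    hG.cosine_eq_neg h h0 (by rw [dist_eq_one_iff_adj.2 hyz, h1]) x
  have hsq : ∀ i, ∀ y, G.dist x y = i → f i ≠ 0 := by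
    intro i
    induction i with
    | zero => intro _ _; rw [h0]; exact one_ne_zero
    | succ i ih =>
      intro y hy
      obtain ⟨z, hz, hzy⟩ := hG.exists_dist_eq_and_dist_eq x y (i := i) (by omega)
      have := hadj z y (dist_eq_one_iff_adj.1 (by omega))
      rw [hy, hz] at this
      rw [this]
      exact neg_ne_zero.2 (ih z hz)
  refine ⟨Coloring.mk (fun y => if 0 < f (G.dist x y) then (0 : Fin 2) else 1) ?_⟩
  intro y z hyz
  have h2 := hadj y z hyz
  have h3 := hsq _ y rfl
  rcases lt_or_gt_of_ne h3 with h4 | h4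
  · have h5 : 0 < f (G.dist x z) := by linarith
    simp [not_lt.2 h4.le, h5]
  · have h5 : ¬ 0 < f (G.dist x z) := by linarith
    simp [h4, h5]

theorem isEigenSequence_one (hG : G.IsDistanceRegular) :
    G.IsEigenSequence (G.drgK : ℝ) fun _ => 1 := fun i hi => by
  have := hG.drgC_add_drgA_add_drgB hi
  simp only [mul_one]
  exact_mod_cast this

theorem drgK_pos (hG : G.IsDistanceRegular) (hd : 1 ≤ G.diam) : 0 < G.drgK := by
  rw [← hG.drgB_zero]
  exact hG.drgB_pos hd

theorem le_drgK (hG : G.IsDistanceRegular) (hd : 1 ≤ G.diam) {θ : ℝ} (h : G.IsEigenvalue θ) :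
    θ ≤ G.drgK := by
  obtain ⟨f, h0, hf, -⟩ := hG.exists_isEigenSequence h
  obtain ⟨x, y, hxy⟩ := hG.exists_dist_eq hd
  have := (hG.abs_cosine_le_one (x := x) (y := y) hf h0).2
  rw [hxy] at this
  rw [hf.eigenvalue_eq hG h0]
  exact mul_le_of_le_one_right (Nat.cast_nonneg _) this

theorem isSecondLargestEigenvalue_iff (hG : G.IsDistanceRegular) (hd : 1 ≤ G.diam) {θ : ℝ} :
    G.IsSecondLargestEigenvalue θ ↔ IsGreatest {η : ℝ | G.IsEigenvalue η ∧ η < G.drgK} θ := by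
  have : {η : ℝ | G.IsEigenvalue η ∧ ∃ μ : ℝ, G.IsEigenvalue μ ∧ η < μ} =
      {η : ℝ | G.IsEigenvalue η ∧ η < G.drgK} := by
    ext η
    refine and_congr_right fun _ => ⟨?_, fun h => ⟨_, ?_, h⟩⟩
    · rintro ⟨μ, hμ, h⟩
      exact h.trans_le (hG.le_drgK hd hμ)
    · exact hG.isEigenvalue_of_isEigenSequence hG.isEigenSequence_one rfl
  rw [IsSecondLargestEigenvalue, this]

theorem finite_eigenvalues : {η : ℝ | G.IsEigenvalue η}.Finite :=
  Module.End.finite_hasEigenvalue _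

/-- Otherwise (A - k)(A + 1) would be positive semidefinite. Its trace is 0, so it would vanish, but
its entries at distance 2 equal c_2 > 0. -/
theorem exists_neg_one_lt_eigenvalue (hG : G.IsDistanceRegular) (hd : 2 ≤ G.diam) :
    ∃ η : ℝ, G.IsEigenvalue η ∧ η < G.drgK ∧ -1 < η := by
  by_contra! hcon
  have hA : G.realAdj.IsHermitian := by
    rw [Matrix.IsHermitian, Matrix.conjTranspose_eq_transpose_of_trivial, realAdj_transpose]
  set P : Matrix V V ℝ := G.realAdj * G.realAdj - ((G.drgK : ℝ) - 1) • G.realAdj -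
    (G.drgK : ℝ) • (1 : Matrix V V ℝ) with hP
  have hpsd : P.PosSemidef := by
    have hlam : ∀ i, 0 ≤ hA.eigenvalues i * hA.eigenvalues i -
        ((G.drgK : ℝ) - 1) * hA.eigenvalues i - G.drgK := by
      intro i
      have h1 : G.IsEigenvalue (hA.eigenvalues i) := by
        rw [IsEigenvalue, Module.End.hasEigenvalue_iff_mem_spectrum, Matrix.spectrum_toLin']
        exact hA.eigenvalues_mem_spectrum_real i
      rcases (hG.le_drgK (by omega) h1).lt_or_eq with h2 | h2
      · nlinarith [hcon _ h1 h2, hG.drgK_pos (by omega)]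
      · rw [h2]; apply le_of_eq; ring
    have hPU : P = Unitary.conjStarAlgAut ℝ _ hA.eigenvectorUnitary (diagonal fun i =>
        hA.eigenvalues i * hA.eigenvalues i -
          ((G.drgK : ℝ) - 1) * hA.eigenvalues i - G.drgK) := by
      have hD : (diagonal fun i => hA.eigenvalues i * hA.eigenvalues i -
          ((G.drgK : ℝ) - 1) * hA.eigenvalues i - G.drgK) =
          diagonal (RCLike.ofReal ∘ hA.eigenvalues) * diagonal (RCLike.ofReal ∘ hA.eigenvalues) -
            ((G.drgK : ℝ) - 1) • diagonal (RCLike.ofReal ∘ hA.eigenvalues) -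
            (G.drgK : ℝ) • (1 : Matrix V V ℝ) := by
        ext i j
        by_cases hij : i = j <;> simp [hij]
      rw [hD, map_sub, map_sub, map_mul, map_smul, map_smul, map_one, ← hA.spectral_theorem]
    rw [hPU, Unitary.conjStarAlgAut_apply]
    exact (Matrix.PosSemidef.diagonal hlam).mul_mul_conjTranspose_same _
  have hrad : P = G.radialMatrix fun i =>
      ((G.drgC i : ℝ) * (if i - 1 = 1 then 1 else 0) + (G.drgA i : ℝ) * (if i = 1 then 1 else 0) +
        (G.drgB i : ℝ) * (if i + 1 = 1 then 1 else 0)) -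
      ((G.drgK : ℝ) - 1) * (if i = 1 then 1 else 0) - (G.drgK : ℝ) * (if i = 0 then 1 else 0) := by
    rw [hP]
    nth_rw 2 [realAdj_eq_radialMatrix]
    rw [hG.realAdj_mul_radialMatrix, realAdj_eq_radialMatrix, one_eq_radialMatrix hG]
    rfl
  have htr : P.trace = 0 := by
    rw [hrad, Matrix.trace]
    refine Finset.sum_eq_zero fun x _ => ?_
    simp [hG.drgB_zero]
  rw [hpsd.trace_eq_zero_iff, hrad] at htr
  obtain ⟨x, y, hxy⟩ := hG.exists_dist_eq hd
  have h2 := congrFun (congrFun htr x) y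
  have h3 := (hG.drgC_pos (i := 1) (by omega)).ne'
  simp [hxy, h3] at h2

end IsDistanceRegular

end Spectrum

/-! ### Cosine sequences as normalized solutions of the recurrence. -/

section CosineSequence

open Matrix
open scoped Classical

variable {V : Type*} [Fintype V] {G : SimpleGraph V}

theorem rank_eq_trace_of_isIdempotentElem {E : Matrix V V ℝ} (hE : E * E = E) :
    (E.rank : ℝ) = E.trace := by
  have h1 : IsIdempotentElem (Matrix.toLin' E) := by
    rw [IsIdempotentElem, Module.End.mul_eq_comp, ← Matrix.toLin'_mul, hE]
  rw [← Matrix.trace_toLin'_eq, (LinearMap.IsIdempotentElem.isProj_range _ h1).trace]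
  rfl

theorem map_eq_smul_sum_distMatrix_iff (hG : G.IsDistanceRegular) {f : ℕ → ℝ} {r : ℂ}
    {σ : ℕ → ℂ} :
    (G.radialMatrix f).map (fun r : ℝ => (r : ℂ)) =
        r • ∑ i ∈ Finset.range (G.diam + 1), σ i • G.distMatrix i ↔
      ∀ i ≤ G.diam, (f i : ℂ) = r * σ i := by
  have key : ∀ x y, (r • ∑ i ∈ Finset.range (G.diam + 1), σ i • G.distMatrix i) x y =
      r * σ (G.dist x y) := by
    intro x y
    have := Nat.lt_succ_of_le (hG.dist_le_diam x y)
    rw [Matrix.smul_apply, Matrix.sum_apply, smul_eq_mul]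
    simp [distMatrix]
    intro h
    omega
  refine ⟨fun h i hi => ?_, fun h => ?_⟩
  · obtain ⟨x, y, rfl⟩ := hG.exists_dist_eq hi
    rw [← key, ← h]
    rfl
  · ext x y
    rw [key, ← h _ (hG.dist_le_diam x y)]
    rfl

/-- The cosine sequences are the solutions of the three-term recurrence with `σ 0 = 1`. -/
theorem isCosineSequence_iff (hG : G.IsDistanceRegular) {θ : ℝ} {σ : ℕ → ℂ} :
    G.IsCosineSequence θ σ ↔ ∃ f : ℕ → ℝ, f 0 = 1 ∧ G.IsEigenSequence θ f ∧
      ∀ i ≤ G.diam, σ i = (f i : ℂ) := by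
  have hne := hG.1.nonempty
  have hcard : (Fintype.card V : ℝ) ≠ 0 := Nat.cast_ne_zero.2 Fintype.card_ne_zero
  have htrace : ∀ f : ℕ → ℝ, (G.radialMatrix f).trace = Fintype.card V * f 0 := by
    intro f
    simp [Matrix.trace]
  constructor
  · rintro ⟨E, ⟨hE, hE0, hEE, hAE⟩, hσ⟩
    rw [Algebra.adjoin_singleton_eq_range_aeval] at hE
    obtain ⟨p, rfl⟩ := hE
    obtain ⟨f, hf⟩ := hG.exists_aeval_eq_radialMatrix p
    have hf' : (Polynomial.aeval G.realAdj).toRingHom p = G.radialMatrix f := hf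
    rw [hf'] at hE0 hEE hAE hσ
    have heig := hG.isEigenSequence_iff.2 hAE
    have hf0 : f 0 ≠ 0 := by
      intro h0
      refine hE0 ?_
      rw [hG.radialMatrix_congr (g := 0) (heig.eq_zero hG h0)]
      rfl
    have hrank := rank_eq_trace_of_isIdempotentElem hEE
    rw [htrace] at hrank
    rw [map_eq_smul_sum_distMatrix_iff hG] at hσ
    have hrank' : ((Fintype.card V : ℂ)⁻¹ * ((G.radialMatrix f).rank : ℂ)) = (f 0 : ℂ) := by
      rw [inv_mul_eq_iff_eq_mul₀ (by exact_mod_cast hcard)]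
      exact_mod_cast hrank
    refine ⟨fun i => (f 0)⁻¹ * f i, inv_mul_cancel₀ hf0, fun i hi => ?_, fun i hi => ?_⟩
    · linear_combination (f 0)⁻¹ * heig i hi
    · have := hσ i hi
      rw [hrank'] at this
      push_cast
      rw [this, inv_mul_cancel_left₀ (by exact_mod_cast hf0)]
  · rintro ⟨f, h0, hf, hσ⟩
    obtain ⟨s, hs, hM⟩ := hG.exists_radialMatrix_mul_self hf h0
    obtain ⟨q, hq⟩ := hG.exists_aeval_eq hf h0
    have hsm : s⁻¹ • G.radialMatrix f = G.radialMatrix fun i => s⁻¹ * f i := rfl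
    -- As M² = sM, the idempotent is s⁻¹M; its trace |X|s⁻¹ is its rank, which is the normalization
    -- in the definition of cosines.
    have hidem : (s⁻¹ • G.radialMatrix f) * (s⁻¹ • G.radialMatrix f) =
        s⁻¹ • G.radialMatrix f := by
      rw [smul_mul_smul_comm, hM, smul_smul, inv_mul_cancel_right₀ hs.ne']
    refine ⟨s⁻¹ • G.radialMatrix f, ⟨?_, ?_, hidem, ?_⟩, ?_⟩
    · refine Subalgebra.smul_mem _ ?_ _
      rw [← hq]
      exact Polynomial.aeval_mem_adjoin_singleton _ _
    · obtain ⟨x⟩ := hne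
      intro h
      have := congrFun (congrFun h x) x
      simp [h0, hs.ne'] at this
    · rw [mul_smul_comm, hG.isEigenSequence_iff.1 hf, smul_comm]
    · have hrank := rank_eq_trace_of_isIdempotentElem hidem
      rw [hsm] at hrank ⊢
      rw [htrace, h0, mul_one] at hrank
      rw [map_eq_smul_sum_distMatrix_iff hG]
      intro i hi
      rw [hσ i hi]
      have : ((G.radialMatrix fun i => s⁻¹ * f i).rank : ℂ) = Fintype.card V * (s : ℂ)⁻¹ := by
        exact_mod_cast hrank
      rw [this, inv_mul_cancel_left₀ (by exact_mod_cast hcard)]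
      push_cast
      rfl

/-- A complex solution of the three-term recurrence with `σ 0 = 1` is real. -/
theorem IsEigenSequence.exists_real (hG : G.IsDistanceRegular) {θ : ℂ} {σ : ℕ → ℂ}
    (h : G.IsEigenSequence θ σ) (h0 : σ 0 = 1) :
    ∃ f : ℕ → ℝ, f 0 = 1 ∧ G.IsEigenSequence θ.re f ∧ ∀ i ≤ G.diam, σ i = (f i : ℂ) := by
  have hre : ∀ i ≤ G.diam, (G.drgC i : ℝ) * (σ (i - 1)).re + (G.drgA i : ℝ) * (σ i).re +
      (G.drgB i : ℝ) * (σ (i + 1)).re = θ.re * (σ i).re - θ.im * (σ i).im := by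
    intro i hi
    simpa using congrArg Complex.re (h i hi)
  have him : ∀ i ≤ G.diam, (G.drgC i : ℝ) * (σ (i - 1)).im + (G.drgA i : ℝ) * (σ i).im +
      (G.drgB i : ℝ) * (σ (i + 1)).im = θ.re * (σ i).im + θ.im * (σ i).re := by
    intro i hi
    simpa using congrArg Complex.im (h i hi)
  obtain ⟨x⟩ := hG.1.nonempty
  set u : V → ℝ := fun z => (σ (G.dist x z)).re with hu
  set w : V → ℝ := fun z => (σ (G.dist x z)).im with hw
  have hAu : G.realAdj *ᵥ u = θ.re • u - θ.im • w := by
    ext z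
    have h1 := hG.sum_adj_dist z x fun i => (σ i).re
    rw [hre _ (hG.dist_le_diam z x), G.dist_comm (u := z)] at h1
    simpa [Matrix.mulVec, dotProduct, realAdj_apply] using h1
  have hAw : G.realAdj *ᵥ w = θ.re • w + θ.im • u := by
    ext z
    have h1 := hG.sum_adj_dist z x fun i => (σ i).im
    rw [him _ (hG.dist_le_diam z x), G.dist_comm (u := z)] at h1
    simpa [Matrix.mulVec, dotProduct, realAdj_apply] using h1
  -- The vector u + iw is an eigenvector of the real symmetric matrix A. Symmetry yields Im θ ·
  -- (‖u‖² + ‖w‖²) = 0; then the imaginary parts solve the recurrence with initial value 0.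
  have hsymm : u ⬝ᵥ (G.realAdj *ᵥ w) = w ⬝ᵥ (G.realAdj *ᵥ u) := by
    rw [Matrix.dotProduct_mulVec, ← Matrix.mulVec_transpose, realAdj_transpose, dotProduct_comm]
  rw [hAu, hAw] at hsymm
  simp only [dotProduct_add, dotProduct_sub, dotProduct_smul, smul_eq_mul,
    dotProduct_comm w u] at hsymm
  have hpos : 0 < u ⬝ᵥ u := by
    refine Finset.sum_pos' (fun y _ => mul_self_nonneg _) ⟨x, Finset.mem_univ _, ?_⟩
    simp [hu, h0]
  have hnn : 0 ≤ w ⬝ᵥ w := Finset.sum_nonneg fun y _ => mul_self_nonneg _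
  have hzero : θ.im = 0 := by
    have h2 : θ.im * (u ⬝ᵥ u + w ⬝ᵥ w) = 0 := by linarith
    exact (mul_eq_zero.1 h2).resolve_right (by positivity)
  have him0 : ∀ i ≤ G.diam, (σ i).im = 0 := by
    refine IsEigenSequence.eq_zero hG (θ := θ.re) (f := fun i => (σ i).im) ?_ (by simp [h0])
    intro i hi
    rw [him i hi, hzero]
    ring
  refine ⟨fun i => (σ i).re, by simp [h0], fun i hi => ?_, fun i hi => ?_⟩
  · rw [hre i hi, hzero]
    ring
  · exact Complex.ext rfl (him0 i hi)

end CosineSequence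

/-! ### Edgewise Cauchy–Schwarz and the Fundamental Bound. -/

section FundamentalBound

open Matrix
open scoped Classical

variable {V : Type*} [Fintype V] {G : SimpleGraph V}

/-- The set of common neighbours of `x` and `y`. -/
noncomputable def commonNbrs (G : SimpleGraph V) (x y : V) : Finset V :=
  Finset.univ.filter fun z => G.Adj x z ∧ G.Adj y z

theorem mem_commonNbrs {x y z : V} : z ∈ G.commonNbrs x y ↔ G.Adj x z ∧ G.Adj y z := by
  simp [commonNbrs]

theorem IsDistanceRegular.card_commonNbrs (hG : G.IsDistanceRegular) {x y : V} (h : G.Adj x y) :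
    (G.commonNbrs x y).card = G.drgA 1 := by
  have := hG.card_filter_adj x y 1
  rw [dist_eq_one_iff_adj.2 h] at this
  rw [drgA, ← this]
  simp [commonNbrs, dist_eq_one_iff_adj]

/-- The number of ordered pairs of adjacent vertices in the common neighbourhood of `x`, `y`. -/
noncomputable def commonNbrsArcs (G : SimpleGraph V) (x y : V) : ℝ :=
  ∑ z ∈ G.commonNbrs x y, ∑ w ∈ G.commonNbrs x y, if G.Adj z w then 1 else 0

/-- Two common neighbours of x and y are at distance 0, 1 or 2, so the double sum depends on the
edge only through its number of arcs. -/
theorem IsDistanceRegular.sum_commonNbrs (hG : G.IsDistanceRegular) {x y : V} (h : G.Adj x y)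
    {f : ℕ → ℝ} (h0 : f 0 = 1) :
    ∑ z ∈ G.commonNbrs x y, ∑ w ∈ G.commonNbrs x y, f (G.dist z w) =
      (G.drgA 1 : ℝ) ^ 2 * f 2 + (f 1 - f 2) * G.commonNbrsArcs x y +
        (1 - f 2) * G.drgA 1 := by
  have key : ∀ z ∈ G.commonNbrs x y, ∀ w ∈ G.commonNbrs x y, f (G.dist z w) =
      f 2 + (f 1 - f 2) * (if G.Adj z w then 1 else 0) + (1 - f 2) * (if z = w then 1 else 0) := by
    intro z hz w hw
    rw [mem_commonNbrs] at hz hw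
    by_cases hzw : z = w
    · subst hzw; simp [h0]
    by_cases hadj : G.Adj z w
    · simp [hzw, hadj, dist_eq_one_iff_adj.2 hadj]
    · have h1 := hG.1.one_lt_dist_of_ne_of_not_adj hzw hadj
      have h2 := hG.1.dist_triangle (u := z) (v := x) (w := w)
      rw [dist_eq_one_iff_adj.2 hw.1, dist_eq_one_iff_adj.2 hz.1.symm] at h2
      have : G.dist z w = 2 := by omega
      simp [hzw, hadj, this]
  rw [Finset.sum_congr rfl fun z hz => Finset.sum_congr rfl (key z hz)]
  simp only [Finset.sum_add_distrib, ← Finset.mul_sum, Finset.sum_const, hG.card_commonNbrs h,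
    commonNbrsArcs]
  have : ∑ z ∈ G.commonNbrs x y, ∑ w ∈ G.commonNbrs x y, (if z = w then (1 : ℝ) else 0) =
      G.drgA 1 := by
    rw [← hG.card_commonNbrs h]
    simp
  rw [this]
  simp only [nsmul_eq_mul]
  ring

theorem IsDistanceRegular.sum_commonNbrs_left (hG : G.IsDistanceRegular) {x y : V}
    (h : G.Adj x y) (f : ℕ → ℝ) :
    ∑ z ∈ G.commonNbrs x y, f (G.dist x z) = (G.drgA 1 : ℝ) * f 1 ∧
      ∑ z ∈ G.commonNbrs x y, f (G.dist y z) = (G.drgA 1 : ℝ) * f 1 := by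
  constructor <;>
  · rw [← hG.card_commonNbrs h, ← nsmul_eq_mul, ← Finset.sum_const]
    refine Finset.sum_congr rfl fun z hz => ?_
    rw [mem_commonNbrs] at hz
    simp [dist_eq_one_iff_adj.2 hz.1, dist_eq_one_iff_adj.2 hz.2]

/-- The Cauchy-Schwarz inequality for an edge `x y`, and what equality means. -/
theorem IsDistanceRegular.edge_inequality (hG : G.IsDistanceRegular) {x y : V} (h : G.Adj x y)
    {θ : ℝ} {f : ℕ → ℝ} (hf : G.IsEigenSequence θ f) (h0 : f 0 = 1) (h1 : -1 < f 1) :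
    0 ≤ (1 + f 1) * ((G.drgA 1 : ℝ) ^ 2 * f 2 + (f 1 - f 2) * G.commonNbrsArcs x y +
        (1 - f 2) * G.drgA 1) - 2 * (G.drgA 1 : ℝ) ^ 2 * f 1 ^ 2 ∧
    ((1 + f 1) * ((G.drgA 1 : ℝ) ^ 2 * f 2 + (f 1 - f 2) * G.commonNbrsArcs x y +
        (1 - f 2) * G.drgA 1) - 2 * (G.drgA 1 : ℝ) ^ 2 * f 1 ^ 2 = 0 →
      ∀ z, (1 + f 1) * ∑ w ∈ G.commonNbrs x y, f (G.dist z w) =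
        G.drgA 1 * f 1 * (f (G.dist z x) + f (G.dist z y))) := by
  set r : V → ℝ := fun w => if w ∈ G.commonNbrs x y then 1 else 0 with hr
  -- The coefficients make u orthogonal to e_x + e_y in the form of f: the pairing of e_x + e_y with
  -- itself is 2(1 + f_1), and with r it is 2a_1f_1.
  set u : V → ℝ := ((G.drgA 1 : ℝ) * f 1) • (Pi.single x 1 + Pi.single y 1) - (1 + f 1) • r with hu
  have hMr : ∀ z, (G.radialMatrix f *ᵥ r) z = ∑ w ∈ G.commonNbrs x y, f (G.dist z w) := by
    intro z
    simp [Matrix.mulVec, dotProduct, hr]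
  have hMu : ∀ z, (G.radialMatrix f *ᵥ u) z =
      G.drgA 1 * f 1 * (f (G.dist z x) + f (G.dist z y)) -
        (1 + f 1) * ∑ w ∈ G.commonNbrs x y, f (G.dist z w) := by
    intro z
    rw [hu, Matrix.mulVec_sub, Matrix.mulVec_smul, Matrix.mulVec_smul, Matrix.mulVec_add]
    simp [hMr]
    ring
  have hrd : ∀ v : V → ℝ, r ⬝ᵥ v = ∑ z ∈ G.commonNbrs x y, v z := by
    intro v
    simp [dotProduct, hr]
  have hQ : u ⬝ᵥ (G.radialMatrix f *ᵥ u) = (1 + f 1) *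
      ((1 + f 1) * ((G.drgA 1 : ℝ) ^ 2 * f 2 + (f 1 - f 2) * G.commonNbrsArcs x y +
        (1 - f 2) * G.drgA 1) - 2 * (G.drgA 1 : ℝ) ^ 2 * f 1 ^ 2) := by
    obtain ⟨hsx, hsy⟩ := hG.sum_commonNbrs_left h f
    have hsx' : ∑ z ∈ G.commonNbrs x y, f (G.dist z x) = (G.drgA 1 : ℝ) * f 1 := by
      simpa only [dist_comm] using hsx
    have hsy' : ∑ z ∈ G.commonNbrs x y, f (G.dist z y) = (G.drgA 1 : ℝ) * f 1 := by
      simpa only [dist_comm] using hsy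
    have e1 : u ⬝ᵥ (G.radialMatrix f *ᵥ u) = G.drgA 1 * f 1 *
        ((G.radialMatrix f *ᵥ u) x + (G.radialMatrix f *ᵥ u) y) -
        (1 + f 1) * ∑ z ∈ G.commonNbrs x y, (G.radialMatrix f *ᵥ u) z := by
      nth_rw 1 [hu]
      rw [sub_dotProduct, smul_dotProduct, smul_dotProduct, add_dotProduct, hrd]
      simp
    rw [e1]
    simp only [hMu, Finset.sum_sub_distrib, ← Finset.mul_sum, Finset.sum_add_distrib, hsx, hsy,
      hsx', hsy', hG.sum_commonNbrs h h0, dist_self, h0, dist_eq_one_iff_adj.2 h,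
      dist_eq_one_iff_adj.2 h.symm]
    ring
  obtain ⟨h2, h3⟩ := hG.dotProduct_radialMatrix hf h0 u
  rw [hQ] at h2 h3
  refine ⟨nonneg_of_mul_nonneg_right h2 (by linarith), fun h4 z => ?_⟩
  have h5 := congrFun (h3 (by rw [h4, mul_zero])) z
  rw [hMu] at h5
  simp only [Pi.zero_apply] at h5
  linarith

theorem fundamental_bound_aux {a b k F s s₂ r r₂ : ℝ} (ha : 0 ≤ a) (hb : 0 < b)
    (hk : k = a + b + 1)
    (hs₂ : k * s ^ 2 = 1 + a * s + b * s₂) (hr₂ : k * r ^ 2 = 1 + a * r + b * r₂)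
    (hs1 : s < 1) (hr : -1 < r)
    (hsk : 0 < 1 + k * s) (hrk : 1 + k * r < 0)
    (hgs : 0 ≤ (1 + s) * (a ^ 2 * s₂ + (s - s₂) * F + (1 - s₂) * a) - 2 * a ^ 2 * s ^ 2)
    (hgr : 0 ≤ (1 + r) * (a ^ 2 * r₂ + (r - r₂) * F + (1 - r₂) * a) - 2 * a ^ 2 * r ^ 2) :
    0 ≤ a * (b + 1 + k * (s + r) + k * (a + 1) * (s * r)) ∧
    (b + 1 + k * (s + r) + k * (a + 1) * (s * r) = 0 →
      (1 + s) * (a ^ 2 * s₂ + (s - s₂) * F + (1 - s₂) * a) - 2 * a ^ 2 * s ^ 2 = 0 ∧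
      (1 + r) * (a ^ 2 * r₂ + (r - r₂) * F + (1 - r₂) * a) - 2 * a ^ 2 * r ^ 2 = 0) := by
  set q : ℝ → ℝ := fun s => (a - b - 1) + (a ^ 2 + a - 2 * b - 2) * s + (a - 1) * k * s ^ 2 with hq
  -- Eliminating s₂ by the recurrence shows that each edge inequality is linear in F, with slope of
  -- the sign of 1 + ks.
  have hN : ∀ s s₂ : ℝ, k * s ^ 2 = 1 + a * s + b * s₂ →
      b * ((1 + s) * (a ^ 2 * s₂ + (s - s₂) * F + (1 - s₂) * a) - 2 * a ^ 2 * s ^ 2) =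
        (1 - s) * (F * (1 + s) * (1 + k * s) - a * q s) := by
    intro s s₂ h
    have h2 : b * s₂ = k * s ^ 2 - 1 - a * s := by linarith
    have : b * ((1 + s) * (a ^ 2 * s₂ + (s - s₂) * F + (1 - s₂) * a) - 2 * a ^ 2 * s ^ 2) =
        (1 + s) * (a ^ 2 * (b * s₂) + (b * s - b * s₂) * F + (b - b * s₂) * a) -
          2 * a ^ 2 * b * s ^ 2 := by ring
    rw [this, h2, hq, hk]
    ring
  have hk0 : 0 < k := by linarith
  have hrs : r < s := by
    have : k * r < k * s := by linarith
    exact lt_of_mul_lt_mul_left this hk0.le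
  have hGs : 0 ≤ F * (1 + s) * (1 + k * s) - a * q s := by
    refine nonneg_of_mul_nonneg_right (a := 1 - s) ?_ (by linarith)
    rw [← hN s s₂ hs₂]
    positivity
  have hGr : 0 ≤ F * (1 + r) * (1 + k * r) - a * q r := by
    refine nonneg_of_mul_nonneg_right (a := 1 - r) ?_ (by linarith)
    rw [← hN r r₂ hr₂]
    positivity
  -- Positive weights chosen to cancel F between the lower and the upper bound.
  have hW : ((1 + s) * (1 + k * s)) * (F * (1 + r) * (1 + k * r) - a * q r) +
      ((1 + r) * (-(1 + k * r))) * (F * (1 + s) * (1 + k * s) - a * q s) =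
      (b * (s - r)) * (a * (b + 1 + k * (s + r) + k * (a + 1) * (s * r))) := by
    rw [hq, hk]
    ring
  have p1 : 0 < (1 + s) * (1 + k * s) := mul_pos (by linarith) hsk
  have p2 : 0 < (1 + r) * (-(1 + k * r)) := mul_pos (by linarith) (by linarith)
  have p3 : 0 < b * (s - r) := mul_pos hb (by linarith)
  have m1 := mul_nonneg p1.le hGr
  have m2 := mul_nonneg p2.le hGs
  refine ⟨nonneg_of_mul_nonneg_right (a := b * (s - r)) (by linarith) p3, fun hT => ?_⟩
  rw [hT, mul_zero, mul_zero] at hW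
  have z1 : F * (1 + r) * (1 + k * r) - a * q r = 0 :=
    (mul_eq_zero.1 (by linarith : (1 + s) * (1 + k * s) * _ = 0)).resolve_left p1.ne'
  have z2 : F * (1 + s) * (1 + k * s) - a * q s = 0 :=
    (mul_eq_zero.1 (by linarith : (1 + r) * (-(1 + k * r)) * _ = 0)).resolve_left p2.ne'
  have n1 := hN s s₂ hs₂
  have n2 := hN r r₂ hr₂
  rw [z2, mul_zero] at n1
  rw [z1, mul_zero] at n2
  exact ⟨(mul_eq_zero.1 n1).resolve_left hb.ne', (mul_eq_zero.1 n2).resolve_left hb.ne'⟩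

theorem IsDistanceRegular.drgK_eq (hG : G.IsDistanceRegular) (hd : 1 ≤ G.diam) :
    G.drgK = G.drgA 1 + G.drgB 1 + 1 := by
  have := hG.drgC_add_drgA_add_drgB hd
  rw [hG.drgC_one hd] at this
  omega

theorem IsEigenSequence.sq_cosine_one {K : Type*} [Field K] [CharZero K]
    (hG : G.IsDistanceRegular) (hd : 1 ≤ G.diam) {θ : K}
    {f : ℕ → K} (hf : G.IsEigenSequence θ f) (h0 : f 0 = 1) :
    (G.drgK : K) * f 1 ^ 2 = 1 + G.drgA 1 * f 1 + G.drgB 1 * f 2 := by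
  have h1 := hf 1 hd
  rw [hf.eigenvalue_eq hG h0, hG.drgC_one hd] at h1
  simp only [Nat.sub_self, h0, Nat.cast_one, one_add_one_eq_two] at h1
  linear_combination -h1

/-- The normalized Fundamental Bound and its case of equality. -/
theorem IsDistanceRegular.fundamental_bound (hG : G.IsDistanceRegular) (hd : 2 ≤ G.diam)
    (hnb : ¬ G.IsBipartite) {θ η : ℝ} {σ ρ : ℕ → ℝ}
    (hσ : G.IsEigenSequence θ σ) (hρ : G.IsEigenSequence η ρ) (hσ0 : σ 0 = 1) (hρ0 : ρ 0 = 1)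
    (hθk : θ < G.drgK) (hθ : -1 < θ) (hη : η < -1) :
    0 ≤ (G.drgA 1 : ℝ) * (G.drgB 1 + 1 + G.drgK * (σ 1 + ρ 1) +
        G.drgK * (G.drgA 1 + 1) * (σ 1 * ρ 1)) ∧
    ((G.drgB 1 : ℝ) + 1 + G.drgK * (σ 1 + ρ 1) + G.drgK * (G.drgA 1 + 1) * (σ 1 * ρ 1) = 0 →
      ∀ x y, G.Adj x y → ∀ z,
        (1 + σ 1) * ∑ w ∈ G.commonNbrs x y, σ (G.dist z w) =
          G.drgA 1 * σ 1 * (σ (G.dist z x) + σ (G.dist z y)) ∧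
        (1 + ρ 1) * ∑ w ∈ G.commonNbrs x y, ρ (G.dist z w) =
          G.drgA 1 * ρ 1 * (ρ (G.dist z x) + ρ (G.dist z y))) := by
  have hk : (G.drgK : ℝ) = G.drgA 1 + G.drgB 1 + 1 := by exact_mod_cast hG.drgK_eq (by omega)
  have hk0 : (0 : ℝ) < G.drgK := by exact_mod_cast hG.drgK_pos (by omega)
  have hb : (0 : ℝ) < G.drgB 1 := by exact_mod_cast hG.drgB_pos (by omega)
  have hσ1 := hG.neg_one_lt_cosine_one hnb (by omega) hσ hσ0
  have hρ1 := hG.neg_one_lt_cosine_one hnb (by omega) hρ hρ0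
  rw [hσ.eigenvalue_eq hG hσ0] at hθk hθ
  rw [hρ.eigenvalue_eq hG hρ0] at hη
  have main : ∀ x y, G.Adj x y → _ := fun x y hxy =>
    fundamental_bound_aux (F := G.commonNbrsArcs x y) (Nat.cast_nonneg (G.drgA 1)) hb hk
      (hσ.sq_cosine_one hG (by omega) hσ0) (hρ.sq_cosine_one hG (by omega) hρ0)
      (by nlinarith) hρ1 (by linarith) (by linarith)
      (hG.edge_inequality hxy hσ hσ0 hσ1).1 (hG.edge_inequality hxy hρ hρ0 hρ1).1
  constructor
  · obtain ⟨x, y, hxy⟩ := hG.exists_dist_eq (i := 1) (by omega)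
    exact (main x y (dist_eq_one_iff_adj.1 hxy)).1
  · intro hT x y hxy z
    obtain ⟨h1, h2⟩ := (main x y hxy).2 hT
    exact ⟨(hG.edge_inequality hxy hσ hσ0 hσ1).2 h1 z, (hG.edge_inequality hxy hρ hρ0 hρ1).2 h2 z⟩

/-- `σ` and `ρ` are cosine sequences of distinct nontrivial eigenvalues of a graph with `a_1 ≠ 0`,
and every edge is tight with respect to both of them. -/
structure IsTightPair (G : SimpleGraph V) (σ ρ : ℕ → ℝ) : Prop where
  a_ne : G.drgA 1 ≠ 0
  left : G.IsEigenSequence (G.drgK * σ 1) σ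
  right : G.IsEigenSequence (G.drgK * ρ 1) ρ
  left_zero : σ 0 = 1
  right_zero : ρ 0 = 1
  left_gt : -1 < σ 1
  right_gt : -1 < ρ 1
  left_lt : σ 1 < 1
  right_lt : ρ 1 < 1
  ne : σ 1 ≠ ρ 1
  left_edge : ∀ x y, G.Adj x y → ∀ z, (1 + σ 1) * ∑ w ∈ G.commonNbrs x y, σ (G.dist z w) =
    G.drgA 1 * σ 1 * (σ (G.dist z x) + σ (G.dist z y))
  right_edge : ∀ x y, G.Adj x y → ∀ z, (1 + ρ 1) * ∑ w ∈ G.commonNbrs x y, ρ (G.dist z w) =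
    G.drgA 1 * ρ 1 * (ρ (G.dist z x) + ρ (G.dist z y))

theorem IsTightPair.symm {σ ρ : ℕ → ℝ} (h : G.IsTightPair σ ρ) : G.IsTightPair ρ σ :=
  ⟨h.a_ne, h.right, h.left, h.right_zero, h.left_zero, h.right_gt, h.left_gt, h.right_lt,
    h.left_lt, h.ne.symm, h.right_edge, h.left_edge⟩

/-- The point is that n does not depend on f, so one count serves both eigenvalues. -/
theorem IsDistanceRegular.exists_sum_commonNbrs_eq (hG : G.IsDistanceRegular) {x y z : V}
    (h : G.Adj x y) {i j : ℕ} (hij : ∀ w ∈ G.commonNbrs x y, G.dist z w = i ∨ G.dist z w = j) :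
    ∃ n : ℝ, ∀ f : ℕ → ℝ, ∑ w ∈ G.commonNbrs x y, f (G.dist z w) =
      n * f i + (G.drgA 1 - n) * f j := by
  refine ⟨((G.commonNbrs x y).filter fun w => G.dist z w = i).card, fun f => ?_⟩
  rw [← Finset.sum_filter_add_sum_filter_not _ fun w => G.dist z w = i]
  have h1 : ∀ w ∈ (G.commonNbrs x y).filter fun w => G.dist z w = i, f (G.dist z w) = f i := by
    intro w hw
    rw [(Finset.mem_filter.1 hw).2]
  have h2 : ∀ w ∈ (G.commonNbrs x y).filter fun w => ¬ G.dist z w = i, f (G.dist z w) = f j := by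
    intro w hw
    rw [Finset.mem_filter] at hw
    rw [(hij w hw.1).resolve_left hw.2]
  rw [Finset.sum_congr rfl h1, Finset.sum_congr rfl h2, Finset.sum_const, Finset.sum_const,
    nsmul_eq_mul, nsmul_eq_mul]
  have h3 : (((G.commonNbrs x y).filter fun w => G.dist z w = i).card : ℝ) +
      ((G.commonNbrs x y).filter fun w => ¬ G.dist z w = i).card = G.drgA 1 := by
    rw [← hG.card_commonNbrs h]
    exact_mod_cast Finset.card_filter_add_card_filter_not _
  rw [← h3]
  ring

/-! ### Consequences of equality at every edge for two eigenvalues. -/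

namespace IsTightPair

variable {σ ρ : ℕ → ℝ}

theorem exists_eq (hG : G.IsDistanceRegular) (h : G.IsTightPair σ ρ) {i : ℕ}
    (hi : i + 1 ≤ G.diam) :
    ∃ n : ℝ, n * (1 + σ 1) * (σ i - σ (i + 1)) = G.drgA 1 * (σ 1 * σ i - σ (i + 1)) ∧
      n * (1 + ρ 1) * (ρ i - ρ (i + 1)) = G.drgA 1 * (ρ 1 * ρ i - ρ (i + 1)) := by
  obtain ⟨x, y, z, hxy, hx, hy⟩ := hG.exists_adj_dist_eq hi
  obtain ⟨n, hn⟩ := hG.exists_sum_commonNbrs_eq (z := z) (i := i) (j := i + 1) hxy (by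
    intro w hw
    rw [mem_commonNbrs] at hw
    have h1 := hG.dist_adj_cases hw.1 z
    have h2 := hG.dist_adj_cases hw.2 z
    omega)
  refine ⟨n, ?_, ?_⟩
  · have h1 := h.left_edge x y hxy z
    rw [hn, G.dist_comm (u := z), G.dist_comm (u := z), hx, hy] at h1
    linear_combination h1
  · have h1 := h.right_edge x y hxy z
    rw [hn, G.dist_comm (u := z), G.dist_comm (u := z), hx, hy] at h1
    linear_combination h1

/-- Obtained by eliminating the common count n from the two identities of `exists_eq`. -/
theorem auxiliary_eq (hG : G.IsDistanceRegular) (h : G.IsTightPair σ ρ) {i : ℕ}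
    (hi : i + 1 ≤ G.diam) :
    (σ 1 - ρ 1) * (σ (i + 1) * ρ (i + 1) - σ i * ρ i) =
      (1 - σ 1 * ρ 1) * (σ i * ρ (i + 1) - ρ i * σ (i + 1)) := by
  obtain ⟨n, h1, h2⟩ := h.exists_eq hG hi
  have ha : (G.drgA 1 : ℝ) ≠ 0 := Nat.cast_ne_zero.2 h.a_ne
  refine mul_left_cancel₀ ha ?_
  linear_combination ((1 + ρ 1) * (ρ i - ρ (i + 1))) * h1 - ((1 + σ 1) * (σ i - σ (i + 1))) * h2

/-- Equal consecutive values would both have to be 0 by `exists_eq`, as a_1 ≠ 0 and σ_1 ≠ 1; a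
nonzero solution of the recurrence excludes that. -/
theorem ne_succ (hG : G.IsDistanceRegular) (h : G.IsTightPair σ ρ) {i : ℕ}
    (hi : i + 1 ≤ G.diam) : σ i ≠ σ (i + 1) := by
  intro heq
  obtain ⟨n, h1, -⟩ := h.exists_eq hG hi
  have ha : (G.drgA 1 : ℝ) ≠ 0 := Nat.cast_ne_zero.2 h.a_ne
  rw [heq, sub_self, mul_zero] at h1
  have h2 : (σ 1 - 1) * σ (i + 1) = 0 := by
    have := (mul_eq_zero.1 h1.symm).resolve_left ha
    linear_combination this
  have h3 := (mul_eq_zero.1 h2).resolve_left (by linarith [h.left_lt])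
  exact h.left.ne_zero_or hG h.left_zero hi ⟨heq.trans h3, h3⟩

/-- If a_d ≠ 0, some edge has both ends at distance d from a vertex z. Edge equality and the last
recurrence then give nk(1 + σ_1) = a_1c_d = nk(1 + ρ_1) with a nonzero value, forcing σ_1 = ρ_1. -/
theorem drgA_diam (hG : G.IsDistanceRegular) (hd : 1 ≤ G.diam) (h : G.IsTightPair σ ρ) :
    G.drgA G.diam = 0 := by
  by_contra hne
  obtain ⟨x, y, z, hxy, hx, hy⟩ := hG.exists_adj_dist_eq_diam hne
  obtain ⟨n, hn⟩ := hG.exists_sum_commonNbrs_eq (z := z) (i := G.diam - 1) (j := G.diam) hxy (by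
    intro w hw
    rw [mem_commonNbrs] at hw
    have h1 := hG.dist_adj_cases hw.1 z
    have h2 := hG.dist_le_diam z w
    omega)
  have hsum : (G.drgK : ℝ) = G.drgC G.diam + G.drgA G.diam := by
    have := hG.drgC_add_drgA_add_drgB le_rfl
    rw [hG.drgB_diam] at this
    exact_mod_cast this.symm
  have key : ∀ τ : ℕ → ℝ, G.IsEigenSequence (G.drgK * τ 1) τ → τ (G.diam - 1) ≠ τ G.diam →
      (1 + τ 1) * ∑ w ∈ G.commonNbrs x y, τ (G.dist z w) =
        G.drgA 1 * τ 1 * (τ (G.dist z x) + τ (G.dist z y)) →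
      n * G.drgK * (1 + τ 1) = G.drgA 1 * G.drgC G.diam := by
    intro τ hτ hne h1
    rw [hn, G.dist_comm (u := z), G.dist_comm (u := z), hx, hy] at h1
    have h2 := hτ G.diam le_rfl
    rw [hG.drgB_diam] at h2
    refine mul_right_cancel₀ (sub_ne_zero.2 hne) ?_
    rw [hsum] at h2 ⊢
    push_cast at h2
    linear_combination (G.drgC G.diam + G.drgA G.diam : ℝ) * h1 - G.drgA 1 * h2
  obtain ⟨e, he⟩ : ∃ e, G.diam = e + 1 := ⟨G.diam - 1, by omega⟩
  have hne1 : σ (G.diam - 1) ≠ σ G.diam := by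
    have := h.ne_succ hG (i := G.diam - 1) (by omega)
    rwa [Nat.sub_add_cancel hd] at this
  have hne2 : ρ (G.diam - 1) ≠ ρ G.diam := by
    have := h.symm.ne_succ hG (i := G.diam - 1) (by omega)
    rwa [Nat.sub_add_cancel hd] at this
  have k1 := key σ h.left hne1 (h.left_edge x y hxy z)
  have k2 := key ρ h.right hne2 (h.right_edge x y hxy z)
  have ha : (G.drgA 1 : ℝ) ≠ 0 := Nat.cast_ne_zero.2 h.a_ne
  have hc : (G.drgC G.diam : ℝ) ≠ 0 := by
    rw [he]
    exact Nat.cast_ne_zero.2 (hG.drgC_pos (by omega)).ne'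
  have hn0 : n * G.drgK ≠ 0 := by
    intro h0
    rw [h0, zero_mul] at k1
    exact mul_ne_zero ha hc k1.symm
  have := mul_left_cancel₀ hn0 (k1.trans k2.symm)
  exact h.ne (by linarith)

end IsTightPair

end FundamentalBound

/-! ### Tightness and the extremal eigenvalues. -/

section Tight

variable {V : Type*} [Fintype V] {G : SimpleGraph V}

/-- With eigenvalues written as k times cosines, the defect in the Fundamental Bound is a positive
multiple of a polynomial expression when k > 0; the latter is the form used everywhere else. -/
theorem tight_sub_eq {a b k s t : ℝ} (ha : 0 ≤ a) (hk : k = a + b + 1) :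
    (k * s + k / (a + 1)) * (k * t + k / (a + 1)) - -(k * a * b) / (a + 1) ^ 2 =
      k / (a + 1) * (b + 1 + k * (s + t) + k * (a + 1) * (s * t)) := by
  have : a + 1 ≠ 0 := by positivity
  field_simp
  rw [hk]
  ring

/-- At a = 0 the expression factors as (b + 1)(1 + s)(1 + t) > 0. -/
theorem drgA_one_pos_of_tight {a b k s t : ℝ} (ha : 0 ≤ a) (hb : 0 < b) (hk : k = a + b + 1)
    (hs : -1 < s) (ht : -1 < t) (hT : b + 1 + k * (s + t) + k * (a + 1) * (s * t) = 0) :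
    0 < a := by
  rcases ha.lt_or_eq with h | h
  · exact h
  · exfalso
    subst h
    have : (b + 1) * ((1 + s) * (1 + t)) = 0 := by
      rw [hk] at hT
      linear_combination hT
    have h1 : 0 < (b + 1) * ((1 + s) * (1 + t)) :=
      mul_pos (by linarith) (mul_pos (by linarith) (by linarith))
    linarith

/-- The product of the two shifted eigenvalues is negative, so they have opposite signs; the shift
k/(a+1) is at least 1. -/
theorem lt_neg_one_of_tight {a b k s t : ℝ} (ha : 0 < a) (hb : 0 < b) (hk : k = a + b + 1)
    (hst : t ≤ s) (hT : b + 1 + k * (s + t) + k * (a + 1) * (s * t) = 0) :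
    0 < k * s + k / (a + 1) ∧ k * t + k / (a + 1) < 0 ∧ k * t < -1 := by
  have h1 := tight_sub_eq (s := s) (t := t) ha.le hk
  rw [hT, mul_zero] at h1
  have hk0 : 0 < k := by linarith
  have h2 : 0 < (k * a * b) / (a + 1) ^ 2 := by positivity
  rw [neg_div] at h1
  have h3 : (k * s + k / (a + 1)) * (k * t + k / (a + 1)) < 0 := by linarith
  have h4 : k * t ≤ k * s := mul_le_mul_of_nonneg_left hst hk0.le
  have h5 : 1 ≤ k / (a + 1) := by
    rw [le_div_iff₀ (by linarith)]
    linarith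
  rcases mul_neg_iff.1 h3 with h | h
  · exact ⟨h.1, h.2, by linarith [h.2]⟩
  · linarith [h.1, h.2]

namespace IsDistanceRegular

theorem neg_one_lt_of_isSecondLargest (hG : G.IsDistanceRegular) (hd : 2 ≤ G.diam) {θ : ℝ}
    (hθ : G.IsSecondLargestEigenvalue θ) : -1 < θ := by
  rw [hG.isSecondLargestEigenvalue_iff (by omega)] at hθ
  obtain ⟨η, h1, h2, h3⟩ := hG.exists_neg_one_lt_eigenvalue hd
  exact h3.trans_le (hθ.2 ⟨h1, h2⟩)

theorem isTightPair_of_tight (hG : G.IsDistanceRegular) (hd : 2 ≤ G.diam)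
    (hnb : ¬ G.IsBipartite) {θ η : ℝ} (hθ : G.IsSecondLargestEigenvalue θ)
    (hη : G.IsMinEigenvalue η)
    (heq : (θ + (G.drgK : ℝ) / ((G.drgA 1 : ℝ) + 1)) * (η + (G.drgK : ℝ) / ((G.drgA 1 : ℝ) + 1)) =
      - ((G.drgK : ℝ) * (G.drgA 1 : ℝ) * (G.drgB 1 : ℝ)) / ((G.drgA 1 : ℝ) + 1) ^ 2)
    {σ ρ : ℕ → ℝ} (hσ : G.IsEigenSequence θ σ) (hρ : G.IsEigenSequence η ρ)
    (hσ0 : σ 0 = 1) (hρ0 : ρ 0 = 1) : G.IsTightPair σ ρ := by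
  have hk : (G.drgK : ℝ) = G.drgA 1 + G.drgB 1 + 1 := by exact_mod_cast hG.drgK_eq (by omega)
  have hk0 : (0 : ℝ) < G.drgK := by exact_mod_cast hG.drgK_pos (by omega)
  have hb : (0 : ℝ) < G.drgB 1 := by exact_mod_cast hG.drgB_pos (by omega)
  have ha : (0 : ℝ) ≤ G.drgA 1 := Nat.cast_nonneg _
  have hσ1 := hG.neg_one_lt_cosine_one hnb (by omega) hσ hσ0
  have hρ1 := hG.neg_one_lt_cosine_one hnb (by omega) hρ hρ0
  have hθ1 := hG.neg_one_lt_of_isSecondLargest hd hθ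
  rw [hG.isSecondLargestEigenvalue_iff (by omega)] at hθ
  have hηθ : η ≤ θ := hη.2 hθ.1.1
  have hθk : θ < G.drgK := hθ.1.2
  have eθ := hσ.eigenvalue_eq hG hσ0
  have eη := hρ.eigenvalue_eq hG hρ0
  subst eθ eη
  have hle : ρ 1 ≤ σ 1 := le_of_mul_le_mul_left hηθ hk0
  have hT : (G.drgB 1 : ℝ) + 1 + G.drgK * (σ 1 + ρ 1) +
      G.drgK * (G.drgA 1 + 1) * (σ 1 * ρ 1) = 0 := by
    have h1 := tight_sub_eq (s := σ 1) (t := ρ 1) ha hk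
    rw [heq, sub_self] at h1
    exact (mul_eq_zero.1 h1.symm).resolve_left (by positivity)
  have ha' := drgA_one_pos_of_tight ha hb hk hσ1 hρ1 hT
  obtain ⟨-, -, hη1⟩ := lt_neg_one_of_tight ha' hb hk hle hT
  have hedge := (hG.fundamental_bound hd hnb hσ hρ hσ0 hρ0 hθk hθ1 hη1).2 hT
  have hlt : ρ 1 < σ 1 := lt_of_mul_lt_mul_left (hη1.trans hθ1) hk0.le
  have hs1 : σ 1 < 1 := lt_of_mul_lt_mul_left (by linarith) hk0.le
  exact ⟨Nat.cast_ne_zero.1 ha'.ne', hσ, hρ, hσ0, hρ0, hσ1, hρ1, hs1, hlt.trans hs1, hlt.ne',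
    fun x y hxy z => (hedge x y hxy z).1, fun x y hxy z => (hedge x y hxy z).2⟩

/-- Equality in the normalized Fundamental Bound for a pair of nontrivial eigenvalues forces
them to be `θ_1` and `θ_d`. -/
theorem extremal_of_tight (hG : G.IsDistanceRegular) (hd : 2 ≤ G.diam)
    (hnb : ¬ G.IsBipartite) {θ η : ℝ} {σ ρ : ℕ → ℝ} (hσ : G.IsEigenSequence θ σ)
    (hρ : G.IsEigenSequence η ρ) (hσ0 : σ 0 = 1) (hρ0 : ρ 0 = 1) (hσ1 : σ 1 ≠ 1)
    (hlt : ρ 1 < σ 1)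
    (hT : (G.drgB 1 : ℝ) + 1 + G.drgK * (σ 1 + ρ 1) +
      G.drgK * (G.drgA 1 + 1) * (σ 1 * ρ 1) = 0) :
    G.IsSecondLargestEigenvalue θ ∧ G.IsMinEigenvalue η := by
  have hk : (G.drgK : ℝ) = G.drgA 1 + G.drgB 1 + 1 := by exact_mod_cast hG.drgK_eq (by omega)
  have hk0 : (0 : ℝ) < G.drgK := by exact_mod_cast hG.drgK_pos (by omega)
  have hb : (0 : ℝ) < G.drgB 1 := by exact_mod_cast hG.drgB_pos (by omega)
  have ha := drgA_one_pos_of_tight (Nat.cast_nonneg (G.drgA 1)) hb hk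
    (hG.neg_one_lt_cosine_one hnb (by omega) hσ hσ0)
    (hG.neg_one_lt_cosine_one hnb (by omega) hρ hρ0) hT
  obtain ⟨hs, ht, ht1⟩ := lt_neg_one_of_tight ha hb hk hlt.le hT
  have eθ := hσ.eigenvalue_eq hG hσ0
  have eη := hρ.eigenvalue_eq hG hρ0
  rw [← eθ] at hs
  rw [← eη] at ht ht1
  have hσe := hG.isEigenvalue_of_isEigenSequence hσ hσ0
  have hρe := hG.isEigenvalue_of_isEigenSequence hρ hρ0
  have hθk : θ < G.drgK := by
    refine lt_of_le_of_ne (hG.le_drgK (by omega) hσe) fun h => hσ1 ?_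
    rw [eθ] at h
    exact mul_left_cancel₀ hk0.ne' (h.trans (mul_one _).symm)
  obtain ⟨θ₁, hθ₁⟩ : ∃ θ₁, IsGreatest {η : ℝ | G.IsEigenvalue η ∧ η < G.drgK} θ₁ := by
    have hfin : {η : ℝ | G.IsEigenvalue η ∧ η < G.drgK}.Finite :=
      finite_eigenvalues.subset fun _ h => h.1
    obtain ⟨m, hm, hmax⟩ := Set.exists_max_image _ id hfin ⟨θ, hσe, hθk⟩
    exact ⟨m, hm, fun x hx => hmax x hx⟩
  obtain ⟨θd, hθd⟩ : ∃ θd, IsLeast {η : ℝ | G.IsEigenvalue η} θd := by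
    obtain ⟨m, hm, hmin⟩ := Set.exists_min_image _ id (finite_eigenvalues (G := G)) ⟨η, hρe⟩
    exact ⟨m, hm, fun x hx => hmin x hx⟩
  have h1 : θ ≤ θ₁ := hθ₁.2 ⟨hσe, hθk⟩
  have h2 : θd ≤ η := hθd.2 hρe
  have hsec := (hG.isSecondLargestEigenvalue_iff (by omega)).2 hθ₁
  obtain ⟨f, hf0, hf, -⟩ := hG.exists_isEigenSequence hθ₁.1.1
  obtain ⟨g, hg0, hg, -⟩ := hG.exists_isEigenSequence hθd.1
  have hbound := (hG.fundamental_bound hd hnb hf hg hf0 hg0 hθ₁.1.2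
    (hG.neg_one_lt_of_isSecondLargest hd hsec) (by linarith)).1
  have hbound' := nonneg_of_mul_nonneg_right hbound ha
  have e1 := tight_sub_eq (s := σ 1) (t := ρ 1) ha.le hk
  have e2 := tight_sub_eq (s := f 1) (t := g 1) ha.le hk
  rw [← eθ, ← eη, hT, mul_zero] at e1
  rw [← hf.eigenvalue_eq hG hf0, ← hg.eigenvalue_eq hG hg0] at e2
  have h3 := mul_nonneg (by positivity : 0 ≤ (G.drgK : ℝ) / (G.drgA 1 + 1)) hbound'
  rw [← e2] at h3
  set κ : ℝ := (G.drgK : ℝ) / (G.drgA 1 + 1) with hκ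
  -- The bound at (θ_1, θ_d) compared with equality at (θ, η). As η + κ < 0 < θ + κ, raising θ or
  -- lowering η would strictly decrease the product.
  have h4 : (θ + κ) * (η + κ) ≤ (θ₁ + κ) * (θd + κ) := by linarith
  have e3 : θ₁ = θ := by
    by_contra hne
    have : θ < θ₁ := lt_of_le_of_ne h1 (Ne.symm hne)
    nlinarith [mul_pos (sub_pos.2 this) (neg_pos.2 ht)]
  have e4 : θd = η := by
    by_contra hne
    have : θd < η := lt_of_le_of_ne h2 hne
    nlinarith [mul_pos (sub_pos.2 this) hs]
  exact ⟨e3 ▸ hsec, e4 ▸ hθd⟩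

theorem exists_isTightPair (hG : G.IsDistanceRegular) (hd : 2 ≤ G.diam) {σ : ℕ → ℂ} {ε : ℂ}
    (h : G.IsTightWith σ ε) :
    ∃ f g : ℕ → ℝ, G.IsTightPair f g ∧ (∀ i ≤ G.diam, σ i = (f i : ℂ)) ∧
      ε = ((1 - f 1 * g 1) / (f 1 - g 1) : ℝ) ∧
      ∀ i, 1 ≤ i → i < G.diam → f (i - 1) ≠ f (i + 1) := by
  obtain ⟨⟨hnb, θ₁, θd, h1, hd', heq⟩, θ, ⟨hcos, -, hfeas⟩, θ', hcomp, hε⟩ := h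
  obtain ⟨f, hf0, hf, hσf⟩ := (isCosineSequence_iff hG).1 hcos
  have hθ' : G.IsEigenvalue θ' := by
    rcases hcomp with hc | hc
    · exact hc.2.1
    · exact hc.2.1.1
  obtain ⟨g, hg0, hg, -⟩ := hG.exists_isEigenSequence hθ'
  refine ⟨f, g, ?_, hσf, ?_, ?_⟩
  · rcases hcomp with hc | hc
    · rw [h1.unique hc.1, hd'.unique hc.2] at heq
      exact hG.isTightPair_of_tight hd hnb hc.1 hc.2 heq hf hg hf0 hg0
    · rw [h1.unique hc.2, hd'.unique hc.1] at heq
      exact (hG.isTightPair_of_tight hd hnb hc.2 hc.1 heq hg hf hg0 hf0).symm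
  · have hk0 : (G.drgK : ℝ) ≠ 0 := Nat.cast_ne_zero.2 (hG.drgK_pos (by omega)).ne'
    rw [hε, hf.eigenvalue_eq hG hf0, hg.eigenvalue_eq hG hg0]
    congr 1
    rw [show (G.drgK : ℝ) ^ 2 - G.drgK * f 1 * (G.drgK * g 1) =
      (G.drgK * G.drgK) * (1 - f 1 * g 1) by ring,
      show (G.drgK : ℝ) * (G.drgK * f 1 - G.drgK * g 1) =
      (G.drgK * G.drgK) * (f 1 - g 1) by ring, mul_div_mul_left _ _ (mul_ne_zero hk0 hk0)]
  · intro i hi hid hne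
    refine hfeas i hi hid ?_
    rw [hσf _ (by omega), hσf _ (by omega), hne]

end IsDistanceRegular

end Tight

/-! ### From tightness to the formulas for the intersection numbers. -/

section Parametrization

/-- The two three-term recurrences at an inner index, solved for `c_i` and `b_i`. -/
theorem solve_recurrences {K : Type*} [Field K] {b c k h ε s t p q w r₀ r r₂ : K} (hr : r ≠ 0)
    (hε : 1 + ε ≠ 0) (hsε : s - ε ≠ 0)
    (h₀ : r * (q - ε * p) = r₀ * (p - ε * q)) (h₂ : r₂ * (w - ε * q) = r * (q - ε * w))
    (hσ : c * (p - q) + b * (w - q) = k * (s - 1) * q)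
    (hρ : c * (r₀ - r) + b * (r₂ - r) = k * (t - 1) * r)
    (ht : t * (s - ε) = 1 - ε * s) (hk : k * (s - 1) = h * (s - ε)) :
    c * ((w - p) * (p - q)) = h * ((w - s * q) * (p - ε * q)) ∧
      b * ((p - w) * (w - q)) = h * ((p - s * q) * (w - ε * q)) := by
  -- Here p, q, w are σ_{i-1}, σ_i, σ_{i+1}. Formally r₀ - r = (1+ε)r(q - p)/(p - εq), and likewise
  -- for r₂, so the second recurrence reads c(p - q)/(p - εq) + b(w - q)/(w - εq) = h. With the
  -- first, this is a 2 × 2 linear system in c(p - q) and b(w - q).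
  have key : c * (p - q) * (w - ε * q) + b * (w - q) * (p - ε * q) =
      h * ((p - ε * q) * (w - ε * q)) := by
    refine mul_left_cancel₀ (mul_ne_zero hr (mul_ne_zero hε hsε)) ?_
    linear_combination (-(s - ε) * (p - ε * q) * (w - ε * q)) * hρ -
      (c * (s - ε) * (w - ε * q)) * h₀ + (b * (s - ε) * (p - ε * q)) * h₂ -
      (k * r * (p - ε * q) * (w - ε * q)) * ht + ((1 + ε) * r * (p - ε * q) * (w - ε * q)) * hk
  constructor
  · linear_combination key - (p - ε * q) * hσ - (p - ε * q) * q * hk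
  · linear_combination key - (w - ε * q) * hσ - (w - ε * q) * q * hk

variable {V : Type*} [Fintype V] {G : SimpleGraph V}

theorem IsEigenSequence.difference_eq {K : Type*} [Field K] [CharZero K]
    (hG : G.IsDistanceRegular) {θ : K} {f : ℕ → K}
    (hf : G.IsEigenSequence θ f) (h0 : f 0 = 1) {i : ℕ} (hi : i ≤ G.diam) :
    (G.drgC i : K) * (f (i - 1) - f i) + G.drgB i * (f (i + 1) - f i) =
      G.drgK * (f 1 - 1) * f i := by
  have h1 := hf i hi
  rw [hf.eigenvalue_eq hG h0] at h1
  have h2 : (G.drgC i : K) + G.drgA i + G.drgB i = G.drgK := by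
    exact_mod_cast hG.drgC_add_drgA_add_drgB hi
  linear_combination h1 - f i * h2

/-- Index 0 is automatic from the choice of eigenvalue. At d, c_d = k leaves a_d = b_d = 0, and the
recurrence is just f_{d-1} = f_1f_d. -/
theorem IsEigenSequence.of_difference_eq {K : Type*} [Field K] [CharZero K]
    (hG : G.IsDistanceRegular) {f : ℕ → K} (h0 : f 0 = 1)
    (h : ∀ j, j + 2 ≤ G.diam → (G.drgC (j + 1) : K) * (f j - f (j + 1)) +
      G.drgB (j + 1) * (f (j + 2) - f (j + 1)) = G.drgK * (f 1 - 1) * f (j + 1))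
    (hlast : f (G.diam - 1) = f 1 * f G.diam) (hcd : (G.drgC G.diam : K) = G.drgK) :
    G.IsEigenSequence (G.drgK * f 1) f := by
  intro i hi
  have h2 : (G.drgC i : K) + G.drgA i + G.drgB i = G.drgK := by
    exact_mod_cast hG.drgC_add_drgA_add_drgB hi
  rcases i with _ | j
  · simp [drgC, hG.drgA_zero, hG.drgB_zero, h0]
  rcases hi.lt_or_eq with hlt | heq
  · have h1 := h j (by omega)
    rw [Nat.add_sub_cancel]
    linear_combination h1 + f (j + 1) * h2
  · rw [heq] at h2 ⊢
    rw [hG.drgB_diam, hcd] at h2 ⊢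
    rw [hlast]
    linear_combination f G.diam * h2

/-- The intersection numbers of `G` are given by the scalars `σ 0, …, σ d, ε, h`. -/
def HasParametrization (G : SimpleGraph V) (σ : ℕ → ℂ) (ε h : ℂ) : Prop :=
  σ 0 = 1 ∧ σ (G.diam - 1) = σ 1 * σ G.diam ∧ ε ≠ -1 ∧
    (σ 1 - 1 ≠ 0 ∧ (G.drgK : ℂ) = h * ((σ 1 - ε) / (σ 1 - 1))) ∧
    (∀ i : ℕ, 1 ≤ i → i ≤ G.diam - 1 →
      (σ (i - 1) - σ (i + 1)) * (σ (i + 1) - σ i) ≠ 0 ∧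
      (G.drgB i : ℂ) =
        h * (((σ (i - 1) - σ 1 * σ i) * (σ (i + 1) - ε * σ i)) /
          ((σ (i - 1) - σ (i + 1)) * (σ (i + 1) - σ i)))) ∧
    (∀ i : ℕ, 1 ≤ i → i ≤ G.diam - 1 →
      (σ (i + 1) - σ (i - 1)) * (σ (i - 1) - σ i) ≠ 0 ∧
      (G.drgC i : ℂ) =
        h * (((σ (i + 1) - σ 1 * σ i) * (σ (i - 1) - ε * σ i)) /
          ((σ (i + 1) - σ (i - 1)) * (σ (i - 1) - σ i)))) ∧
    (σ 1 - 1 ≠ 0 ∧ (G.drgC G.diam : ℂ) = h * ((σ 1 - ε) / (σ 1 - 1)))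

theorem IsTightWith.hasParametrization (hG : G.IsDistanceRegular) (hd : 2 ≤ G.diam) {σ : ℕ → ℂ}
    {ε h : ℂ} (hT : G.IsTightWith σ ε)
    (hh : h = ((1 - σ 1) * (1 - σ 2)) / ((σ 1 ^ 2 - σ 2) * (1 - ε * σ 1))) :
    G.HasParametrization σ ε h := by
  obtain ⟨f, g, hp, hσ, hε, hfeas⟩ := hG.exists_isTightPair hd hT
  set e : ℝ := (1 - f 1 * g 1) / (f 1 - g 1) with he
  have hne : f 1 - g 1 ≠ 0 := sub_ne_zero.2 hp.ne
  have he' : e * (f 1 - g 1) = 1 - f 1 * g 1 := div_mul_cancel₀ _ hne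
  have hf1 : f 1 - 1 ≠ 0 := by linarith [hp.left_lt]
  have e1 : 1 + e ≠ 0 := by
    intro h0
    have : (1 + f 1) * (1 - g 1) = 0 := by linear_combination (f 1 - g 1) * h0 - he'
    rcases mul_eq_zero.1 this with h1 | h1
    · linarith [hp.left_gt]
    · linarith [hp.right_lt]
  have e2 : 1 - e ≠ 0 := by
    intro h0
    have : (1 - f 1) * (1 + g 1) = 0 := by linear_combination (-(f 1 - g 1)) * h0 - he'
    rcases mul_eq_zero.1 this with h1 | h1
    · linarith [hp.left_lt]
    · linarith [hp.right_gt]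
  have e3 : f 1 - e ≠ 0 := by
    intro h0
    have : (1 - f 1) * (1 + f 1) = 0 := by linear_combination (-(f 1 - g 1)) * h0 - he'
    rcases mul_eq_zero.1 this with h1 | h1
    · linarith [hp.left_lt]
    · linarith [hp.left_gt]
  have ht : g 1 * (f 1 - e) = 1 - e * f 1 := by linear_combination he'
  have hE : ∀ i, i + 1 ≤ G.diam → g (i + 1) * (f (i + 1) - e * f i) =
      g i * (f i - e * f (i + 1)) := by
    intro i hi
    refine mul_left_cancel₀ hne ?_
    linear_combination hp.auxiliary_eq hG hi -
      (f i * g (i + 1) - g i * f (i + 1)) * he'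
  have hcd : G.drgC G.diam = G.drgK := by
    have := hG.drgC_add_drgA_add_drgB le_rfl
    rwa [hG.drgB_diam, hp.drgA_diam hG (by omega)] at this
  have hk0 : (G.drgK : ℝ) ≠ 0 := Nat.cast_ne_zero.2 (hG.drgK_pos (by omega)).ne'
  have hlast : ∀ {τ : ℕ → ℝ}, G.IsEigenSequence (G.drgK * τ 1) τ →
      τ (G.diam - 1) = τ 1 * τ G.diam := by
    intro τ hτ
    have h1 := hτ G.diam le_rfl
    rw [hG.drgB_diam, hp.drgA_diam hG (by omega), hcd] at h1
    refine mul_left_cancel₀ hk0 ?_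
    linear_combination h1
  -- An inner zero g_{j+1} has nonzero neighbours, so `hE` gives f_j = e f_{j+1} = f_{j+2}, against
  -- feasibility. A zero at d would force g_{d-1} = 0 as well.
  have hg : ∀ i ≤ G.diam, g i ≠ 0 := by
    intro i hi h0
    rcases hi.lt_or_eq with hlt | rfl
    · rcases i with _ | j
      · simp [hp.right_zero] at h0
      have n1 : g j ≠ 0 := fun h1 => hp.right.ne_zero_or hG hp.right_zero (i := j) (by omega) ⟨h1, h0⟩
      have n2 : g (j + 2) ≠ 0 := fun h1 =>
        hp.right.ne_zero_or hG hp.right_zero (i := j + 1) (by omega) ⟨h0, h1⟩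
      have h1 := hE j (by omega)
      have h2 := hE (j + 1) (by omega)
      rw [h0, zero_mul] at h1 h2
      have h3 := (mul_eq_zero.1 h1.symm).resolve_left n1
      have h4 := (mul_eq_zero.1 h2).resolve_left n2
      exact hfeas (j + 1) (by omega) hlt (by
        rw [Nat.add_sub_cancel]
        linear_combination h3 - h4)
    · have h1 := hlast hp.right
      rw [h0, mul_zero] at h1
      refine hp.right.ne_zero_or hG hp.right_zero (i := G.diam - 1) (by omega) ⟨h1, ?_⟩
      rwa [Nat.sub_add_cancel (by omega)]
  set η : ℝ := G.drgK * (f 1 - 1) / (f 1 - e) with hη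
  have hη' : G.drgK * (f 1 - 1) = η * (f 1 - e) := (div_mul_cancel₀ _ e3).symm
  have hsolve : ∀ j, j + 2 ≤ G.diam →
      (G.drgC (j + 1) : ℝ) * ((f (j + 2) - f j) * (f j - f (j + 1))) =
        η * ((f (j + 2) - f 1 * f (j + 1)) * (f j - e * f (j + 1))) ∧
      (G.drgB (j + 1) : ℝ) * ((f j - f (j + 2)) * (f (j + 2) - f (j + 1))) =
        η * ((f j - f 1 * f (j + 1)) * (f (j + 2) - e * f (j + 1))) := fun j hj =>
    solve_recurrences (hg (j + 1) (by omega)) e1 e3 (hE j (by omega)) (hE (j + 1) (by omega))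
      (hp.left.difference_eq hG hp.left_zero (i := j + 1) (by omega))
      (hp.right.difference_eq hG hp.right_zero (i := j + 1) (by omega)) ht hη'
  have hden : ∀ j, j + 2 ≤ G.diam → f j - f (j + 2) ≠ 0 ∧ f j - f (j + 1) ≠ 0 ∧
      f (j + 2) - f (j + 1) ≠ 0 := fun j hj =>
    ⟨sub_ne_zero.2 (hfeas (j + 1) (by omega) (by omega)),
      sub_ne_zero.2 (hp.ne_succ hG (by omega)), sub_ne_zero.2 (hp.ne_succ hG (by omega)).symm⟩
  -- The scalar η is forced by the formula for k; the formula for c_1 = 1 identifies it with h.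
  have hhη : h = (η : ℂ) := by
    rw [hh, hε, hσ 1 (by omega), hσ 2 (by omega)]
    have h1 := (hsolve 0 hd).1
    obtain ⟨d1, d2, -⟩ := hden 0 hd
    rw [zero_add, hG.drgC_one (by omega), hp.left_zero, Nat.cast_one, one_mul] at h1
    rw [zero_add, hp.left_zero] at d1 d2
    have d3 : (f 1 ^ 2 - f 2) * (1 - e * f 1) ≠ 0 := by
      intro h0
      refine mul_ne_zero d1 d2 ?_
      linear_combination -h1 + η * h0
    have h2 : (1 - f 1) * (1 - f 2) / ((f 1 ^ 2 - f 2) * (1 - e * f 1)) = η := by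
      rw [div_eq_iff d3]
      linear_combination -h1
    exact_mod_cast congrArg (fun r : ℝ => (r : ℂ)) h2
  have hkk : (G.drgK : ℝ) = η * ((f 1 - e) / (f 1 - 1)) := by
    rw [← mul_div_assoc, eq_div_iff hf1, hη']
  have hfirst : σ 1 - 1 ≠ 0 ∧ (G.drgK : ℂ) = h * ((σ 1 - ε) / (σ 1 - 1)) := by
    rw [hhη, hε, hσ 1 (by omega)]
    exact ⟨by exact_mod_cast hf1, by exact_mod_cast congrArg (fun r : ℝ => (r : ℂ)) hkk⟩
  refine ⟨by rw [hσ 0 (by omega), hp.left_zero, Complex.ofReal_one], ?_, ?_, hfirst, ?_, ?_,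
    by rw [hcd]; exact hfirst⟩
  · rw [hσ _ (by omega), hσ 1 (by omega), hσ _ le_rfl, hlast hp.left, Complex.ofReal_mul]
  · rw [hε]
    intro h0
    have : e = -1 := by exact_mod_cast h0
    exact e1 (by linarith)
  · intro i hi hid
    obtain ⟨j, rfl⟩ : ∃ j, i = j + 1 := ⟨i - 1, by omega⟩
    obtain ⟨d1, d2, d3⟩ := hden j (by omega)
    rw [hhη, hε, hσ _ (by omega), hσ _ (by omega), hσ _ (by omega), hσ _ (by omega),
      Nat.add_sub_cancel]
    have d4 := mul_ne_zero d1 d3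
    refine ⟨by exact_mod_cast d4, ?_⟩
    have := (hsolve j (by omega)).2
    rw [← eq_div_iff d4, mul_div_assoc] at this
    exact_mod_cast congrArg (fun r : ℝ => (r : ℂ)) this
  · intro i hi hid
    obtain ⟨j, rfl⟩ : ∃ j, i = j + 1 := ⟨i - 1, by omega⟩
    obtain ⟨d1, d2, d3⟩ := hden j (by omega)
    rw [hhη, hε, hσ _ (by omega), hσ _ (by omega), hσ _ (by omega), hσ _ (by omega),
      Nat.add_sub_cancel]
    have d4 : (f (j + 2) - f j) * (f j - f (j + 1)) ≠ 0 :=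
      mul_ne_zero (by rw [← neg_sub]; exact neg_ne_zero.2 d1) d2
    refine ⟨by exact_mod_cast d4, ?_⟩
    have := (hsolve j (by omega)).1
    rw [← eq_div_iff d4, mul_div_assoc] at this
    exact_mod_cast congrArg (fun r : ℝ => (r : ℂ)) this

end Parametrization

/-! ### From the formulas back to tightness, and uniqueness. -/

section Converse

/-- Multiplying the relation by b² and eliminating s₂ and t₂ turns it into (s - t)(s - 1)(t - 1)
times the tightness expression. -/
theorem tight_of_cosines {a b k s t s₂ t₂ : ℝ} (hk : k = a + b + 1)
    (hs : k * s ^ 2 = 1 + a * s + b * s₂) (ht : k * t ^ 2 = 1 + a * t + b * t₂)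
    (hs1 : s ≠ 1) (ht1 : t ≠ 1) (hst : s ≠ t)
    (h : (s - t) * (s₂ * t₂ - s * t) = (1 - s * t) * (s * t₂ - t * s₂)) :
    b + 1 + k * (s + t) + k * (a + 1) * (s * t) = 0 := by
  have h1 : b * s₂ = k * s ^ 2 - 1 - a * s := by linarith
  have h2 : b * t₂ = k * t ^ 2 - 1 - a * t := by linarith
  have h3 : (s - t) * ((b * s₂) * (b * t₂) - b ^ 2 * (s * t)) =
      b * ((1 - s * t) * (s * (b * t₂) - t * (b * s₂))) := by
    linear_combination b ^ 2 * h
  rw [h1, h2, hk] at h3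
  refine mul_left_cancel₀ (mul_ne_zero (sub_ne_zero.2 hst)
    (mul_ne_zero (sub_ne_zero.2 hs1) (sub_ne_zero.2 ht1))) ?_
  rw [hk]
  linear_combination h3

/-- The companion sequence `ρ_i = ∏_{j=1}^i (σ_{j-1} - ε σ_j) / (σ_j - ε σ_{j-1})`. -/
noncomputable def companionSequence {K : Type*} [Field K] (σ : ℕ → K) (ε : K) : ℕ → K
  | 0 => 1
  | i + 1 => companionSequence σ ε i * ((σ i - ε * σ (i + 1)) / (σ (i + 1) - ε * σ i))

/-- The parametrized `c_i`, `b_i` satisfy both three-term recurrences. -/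
theorem recurrences_of_parametrization {K : Type*} [Field K] {b c k h ε s t p q w r₀ r r₂ : K}
    (hsε : s - ε ≠ 0) (hpw : p - w ≠ 0) (hp : p - ε * q ≠ 0) (hw : w - ε * q ≠ 0)
    (hc : c * ((w - p) * (p - q)) = h * ((w - s * q) * (p - ε * q)))
    (hb : b * ((p - w) * (w - q)) = h * ((p - s * q) * (w - ε * q)))
    (h₀ : r * (q - ε * p) = r₀ * (p - ε * q)) (h₂ : r₂ * (w - ε * q) = r * (q - ε * w))
    (ht : t * (s - ε) = 1 - ε * s) (hk : k * (s - 1) = h * (s - ε)) :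
    c * (p - q) + b * (w - q) = k * (s - 1) * q ∧
      c * (r₀ - r) + b * (r₂ - r) = k * (t - 1) * r := by
  constructor
  · refine mul_left_cancel₀ hpw ?_
    linear_combination hb - hc - (p - w) * q * hk
  · refine mul_left_cancel₀ (mul_ne_zero (mul_ne_zero hpw hsε) (mul_ne_zero hp hw)) ?_
    linear_combination (-(c * (p - w) * (s - ε) * (w - ε * q))) * h₀ +
      (b * (p - w) * (s - ε) * (p - ε * q)) * h₂ +
      ((1 + ε) * r * (s - ε) * (w - ε * q)) * hc -
      ((1 + ε) * r * (s - ε) * (p - ε * q)) * hb -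
      (k * r * (p - w) * (p - ε * q) * (w - ε * q)) * ht +
      ((1 + ε) * r * (p - w) * (p - ε * q) * (w - ε * q)) * hk

variable {V : Type*} [Fintype V] {G : SimpleGraph V}

theorem HasParametrization.cross_mul {σ : ℕ → ℂ} {ε h : ℂ} (H : G.HasParametrization σ ε h)
    {j : ℕ} (hj : j + 2 ≤ G.diam) :
    σ j - σ (j + 2) ≠ 0 ∧
      (G.drgC (j + 1) : ℂ) * ((σ (j + 2) - σ j) * (σ j - σ (j + 1))) =
        h * ((σ (j + 2) - σ 1 * σ (j + 1)) * (σ j - ε * σ (j + 1))) ∧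
      (G.drgB (j + 1) : ℂ) * ((σ j - σ (j + 2)) * (σ (j + 2) - σ (j + 1))) =
        h * ((σ j - σ 1 * σ (j + 1)) * (σ (j + 2) - ε * σ (j + 1))) := by
  obtain ⟨-, -, -, -, hB, hC, -⟩ := H
  obtain ⟨d1, e1⟩ := hB (j + 1) (by omega) (by omega)
  obtain ⟨d2, e2⟩ := hC (j + 1) (by omega) (by omega)
  rw [Nat.add_sub_cancel] at d1 e1 d2 e2
  exact ⟨(mul_ne_zero_iff.1 d1).1, by rw [e2, ← mul_div_assoc, div_mul_cancel₀ _ d2],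
    by rw [e1, ← mul_div_assoc, div_mul_cancel₀ _ d1]⟩

theorem HasParametrization.isTightWith (hG : G.IsDistanceRegular) (hd : 2 ≤ G.diam)
    (hnb : ¬ G.IsBipartite) {σ : ℕ → ℂ} {ε h : ℂ} (H : G.HasParametrization σ ε h) :
    G.IsTightWith σ ε ∧
      h = ((1 - σ 1) * (1 - σ 2)) / ((σ 1 ^ 2 - σ 2) * (1 - ε * σ 1)) := by
  have hcross := fun {j : ℕ} (hj : j + 2 ≤ G.diam) => H.cross_mul hj
  obtain ⟨h0, hlast, hε, ⟨hs1, hk⟩, hB, hC, ⟨-, hcd⟩⟩ := H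
  have hk0 : (G.drgK : ℂ) ≠ 0 := Nat.cast_ne_zero.2 (hG.drgK_pos (by omega)).ne'
  have hcdk : (G.drgC G.diam : ℂ) = G.drgK := hcd.trans hk.symm
  have hsε : σ 1 - ε ≠ 0 := by
    intro h'
    rw [h', zero_div, mul_zero] at hk
    exact hk0 hk
  have hk' : (G.drgK : ℂ) * (σ 1 - 1) = h * (σ 1 - ε) := by
    rw [hk, ← mul_div_assoc, div_mul_cancel₀ _ hs1]
  -- These factors occur in the numerators for k (i = 0) and b_i, which are nonzero; the factors in
  -- `hnum` occur likewise in c_i.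
  have hden : ∀ i, i + 1 ≤ G.diam → σ (i + 1) - ε * σ i ≠ 0 := by
    intro i hi h'
    rcases i with _ | j
    · rw [h0, mul_one] at h'
      exact hsε h'
    · have h1 := (hB (j + 1) (by omega) (by omega)).2
      rw [h', mul_zero, zero_div, mul_zero] at h1
      exact (hG.drgB_pos (by omega)).ne' (Nat.cast_eq_zero.1 h1)
  have hnum : ∀ j, j + 2 ≤ G.diam → σ j - ε * σ (j + 1) ≠ 0 := by
    intro j hj h'
    have h1 := (hC (j + 1) (by omega) (by omega)).2
    rw [Nat.add_sub_cancel, h', mul_zero, zero_div, mul_zero] at h1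
    exact (hG.drgC_pos (by omega)).ne' (Nat.cast_eq_zero.1 h1)
  set ρ := companionSequence σ ε with hρ
  have hρ0 : ρ 0 = 1 := rfl
  have hstep : ∀ i, i + 1 ≤ G.diam → ρ (i + 1) * (σ (i + 1) - ε * σ i) =
      ρ i * (σ i - ε * σ (i + 1)) := by
    intro i hi
    rw [hρ, companionSequence, mul_assoc, div_mul_cancel₀ _ (hden i hi)]
  have ht : ρ 1 * (σ 1 - ε) = 1 - ε * σ 1 := by
    have := hstep 0 (by omega)
    simpa [h0, hρ0] using this
  have hrec := fun (j : ℕ) (hj : j + 2 ≤ G.diam) =>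
    recurrences_of_parametrization hsε (hcross hj).1 (hnum j hj) (hden (j + 1) hj) (hcross hj).2.1
      (hcross hj).2.2 (hstep j (by omega)) (hstep (j + 1) hj) ht hk'
  have hσeig : G.IsEigenSequence (G.drgK * σ 1) σ :=
    .of_difference_eq hG h0 (fun j hj => (hrec j hj).1) hlast hcdk
  have hρlast : ρ (G.diam - 1) = ρ 1 * ρ G.diam := by
    have h1 := hstep (G.diam - 1) (by omega)
    have h2 := hden (G.diam - 1) (by omega)
    rw [Nat.sub_add_cancel (by omega), hlast] at h1 h2
    have h3 : σ G.diam ≠ 0 := by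
      intro h3
      rw [h3] at h2
      simp at h2
    refine mul_left_cancel₀ (mul_ne_zero hsε h3) ?_
    linear_combination -h1 - σ G.diam * ρ G.diam * ht
  have hρeig : G.IsEigenSequence (G.drgK * ρ 1) ρ :=
    .of_difference_eq hG hρ0 (fun j hj => (hrec j hj).2) hρlast hcdk
  obtain ⟨f, hf0, hf, hσf⟩ := hσeig.exists_real hG h0
  obtain ⟨g, hg0, hg, hρg⟩ := hρeig.exists_real hG hρ0
  have hf1 := hσf 1 (by omega)
  have hg1 := hρg 1 (by omega)
  have hfgt := hG.neg_one_lt_cosine_one hnb (by omega) hf hf0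
  have hf1' : f 1 ≠ 1 := by
    intro h'
    rw [hf1, h', Complex.ofReal_one, sub_self] at hs1
    exact hs1 rfl
  -- This is where ε ≠ -1 enters: ρ_1 = 1 would mean (1 + ε)(σ_1 - 1) = 0.
  have hg1' : g 1 ≠ 1 := by
    intro h'
    rw [hg1, h', Complex.ofReal_one, one_mul] at ht
    have : (1 + ε) * (σ 1 - 1) = 0 := by linear_combination ht
    rcases mul_eq_zero.1 this with h1 | h1
    · exact hε (by linear_combination h1)
    · exact hs1 h1
  have hεst : ε * (σ 1 - ρ 1) = 1 - σ 1 * ρ 1 := by linear_combination ht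
  have hfle : f 1 ≤ 1 := by
    obtain ⟨x, y, hxy⟩ := hG.exists_dist_eq (i := 1) (by omega)
    exact hxy ▸ (hG.abs_cosine_le_one hf hf0).2
  have hflt : f 1 < 1 := lt_of_le_of_ne hfle hf1'
  have hfg : f 1 ≠ g 1 := by
    intro h'
    rw [hf1, hg1, ← h', sub_self, mul_zero] at hεst
    have h1 : (1 - f 1) * (1 + f 1) = 0 := by
      have : (1 : ℝ) - f 1 * f 1 = 0 := by exact_mod_cast hεst.symm
      linear_combination this
    rcases mul_eq_zero.1 h1 with h2 | h2
    · linarith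
    · linarith
  have haux : (f 1 - g 1) * (f 2 * g 2 - f 1 * g 1) =
      (1 - f 1 * g 1) * (f 1 * g 2 - g 1 * f 2) := by
    have h1 := hstep 1 (by omega)
    have h2 : (σ 1 - ρ 1) * (σ 2 * ρ 2 - σ 1 * ρ 1) =
        (1 - σ 1 * ρ 1) * (σ 1 * ρ 2 - ρ 1 * σ 2) := by
      linear_combination (σ 1 - ρ 1) * h1 + (σ 1 * ρ 2 - ρ 1 * σ 2) * hεst
    rw [hf1, hg1, hσf 2 hd, hρg 2 hd] at h2
    exact_mod_cast h2
  have hT := tight_of_cosines (k := (G.drgK : ℝ)) (a := G.drgA 1) (b := G.drgB 1)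
    (by exact_mod_cast hG.drgK_eq (by omega)) (hf.sq_cosine_one hG (by omega) hf0)
    (hg.sq_cosine_one hG (by omega) hg0) hf1' hg1' hfg haux
  set θ := ((G.drgK : ℂ) * σ 1).re
  set η := ((G.drgK : ℂ) * ρ 1).re
  have hcomp : G.AreComplementary θ η := by
    rcases lt_or_gt_of_ne hfg with hlt | hlt
    · refine Or.inr (hG.extremal_of_tight hd hnb hg hf hg0 hf0 hg1' hlt ?_).symm
      linear_combination hT
    · exact Or.inl (hG.extremal_of_tight hd hnb hf hg hf0 hg0 hf1' hlt hT)
  have eθ := hf.eigenvalue_eq hG hf0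
  have eη := hg.eigenvalue_eq hG hg0
  have htight : (θ + (G.drgK : ℝ) / ((G.drgA 1 : ℝ) + 1)) *
      (η + (G.drgK : ℝ) / ((G.drgA 1 : ℝ) + 1)) =
      - ((G.drgK : ℝ) * (G.drgA 1 : ℝ) * (G.drgB 1 : ℝ)) / ((G.drgA 1 : ℝ) + 1) ^ 2 := by
    have h1 := tight_sub_eq (s := f 1) (t := g 1) (Nat.cast_nonneg (G.drgA 1))
      (show (G.drgK : ℝ) = G.drgA 1 + G.drgB 1 + 1 by exact_mod_cast hG.drgK_eq (by omega))
    rw [hT, mul_zero, ← eθ, ← eη] at h1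
    exact sub_eq_zero.1 h1
  refine ⟨⟨⟨hnb, ?_⟩, θ, ⟨(isCosineSequence_iff hG).2 ⟨f, hf0, hf, hσf⟩, ?_, ?_⟩, η, hcomp, ?_⟩, ?_⟩
  · rcases hcomp with hc | hc
    · exact ⟨θ, η, hc.1, hc.2, htight⟩
    · exact ⟨η, θ, hc.2, hc.1, by rw [mul_comm]; exact htight⟩
  · exact hcomp.imp And.left And.left
  · intro i hi hid
    obtain ⟨j, rfl⟩ : ∃ j, i = j + 1 := ⟨i - 1, by omega⟩
    rw [Nat.add_sub_cancel]
    exact sub_ne_zero.1 (hcross (by omega)).1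
  · have hk0' : (G.drgK : ℝ) ≠ 0 := by exact_mod_cast hk0
    rw [eθ, eη, show (G.drgK : ℝ) ^ 2 - G.drgK * f 1 * (G.drgK * g 1) =
      (G.drgK * G.drgK) * (1 - f 1 * g 1) by ring,
      show (G.drgK : ℝ) * (G.drgK * f 1 - G.drgK * g 1) =
      (G.drgK * G.drgK) * (f 1 - g 1) by ring, mul_div_mul_left _ _ (mul_ne_zero hk0' hk0')]
    rw [hf1, hg1] at hεst
    have : (f 1 : ℂ) - g 1 ≠ 0 := by exact_mod_cast sub_ne_zero.2 hfg
    push_cast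
    rw [eq_div_iff this, hεst]
  · have h1 := (hcross (j := 0) hd).2.1
    have h2 := hC 1 le_rfl (by omega)
    simp only [zero_add, hG.drgC_one (show 1 ≤ G.diam by omega), h0, Nat.cast_one, one_mul,
      Nat.sub_self, one_add_one_eq_two] at h1 h2
    have h3 : (σ 1 ^ 2 - σ 2) * (1 - ε * σ 1) ≠ 0 := by
      intro h'
      refine h2.1 ?_
      linear_combination h1 - h * h'
    rw [eq_div_iff h3]
    linear_combination h1

/-- If σ_1 = 0, the factor σ_1 - σ_1σ_2 makes b_2 = 0, impossible when d ≥ 3. -/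
theorem HasParametrization.cosine_one_ne_zero (hG : G.IsDistanceRegular) (hd : 3 ≤ G.diam)
    {σ : ℕ → ℂ} {ε h : ℂ} (H : G.HasParametrization σ ε h) : σ 1 ≠ 0 := by
  intro h1
  obtain ⟨-, -, -, -, hB, -, -⟩ := H
  have h2 := (hB 2 (by omega) (by omega)).2
  simp only [Nat.add_one_sub_one, h1, zero_mul, sub_zero, zero_div, mul_zero] at h2
  exact (hG.drgB_pos (by omega)).ne' (Nat.cast_eq_zero.1 h2)

/-- The scalars `σ 1, …, σ (d - 1), ε` determine the intersection numbers. -/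
theorem IsTightWith.intersectionNumbers_eq {W : Type*} [Fintype W] {G' : SimpleGraph W}
    (hG : G.IsDistanceRegular) (hG' : G'.IsDistanceRegular) (hd : 3 ≤ G.diam)
    (hdiam : G'.diam = G.diam) {σ τ : ℕ → ℂ} {ε : ℂ} (hσ : G.IsTightWith σ ε)
    (hτ : G'.IsTightWith τ ε) (hστ : ∀ i : ℕ, 1 ≤ i → i ≤ G.diam - 1 → σ i = τ i) :
    G.drgK = G'.drgK ∧ ∀ i : ℕ, i ≤ G.diam →
      G.drgA i = G'.drgA i ∧ G.drgB i = G'.drgB i ∧ G.drgC i = G'.drgC i := by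
  have H := hσ.hasParametrization hG (by omega) rfl
  have H' := hτ.hasParametrization hG' (by omega) rfl
  have hne := H.cosine_one_ne_zero hG hd
  -- Since d - 1 ≥ 2, the scalars σ_1, σ_2 and hence h agree for the two graphs.
  rw [← hστ 1 le_rfl (by omega), ← hστ 2 (by omega) (by omega)] at H'
  set h := ((1 - σ 1) * (1 - σ 2)) / ((σ 1 ^ 2 - σ 2) * (1 - ε * σ 1))
  obtain ⟨h0, hlast, -, ⟨-, hk⟩, hB, hC, ⟨-, hcd⟩⟩ := H
  obtain ⟨h0', hlast', -, ⟨-, hk'⟩, hB', hC', ⟨-, hcd'⟩⟩ := H'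
  rw [hdiam] at hlast' hB' hC' hcd'
  have hall : ∀ i ≤ G.diam, τ i = σ i := by
    intro i hi
    rcases Nat.eq_zero_or_pos i with rfl | hpos
    · rw [h0, h0']
    rcases hi.lt_or_eq with hlt | rfl
    · exact (hστ i hpos (by omega)).symm
    · rw [← hστ 1 le_rfl (by omega), ← hστ (G.diam - 1) (by omega) le_rfl, hlast] at hlast'
      exact (mul_left_cancel₀ hne hlast').symm
  rw [hall 1 (by omega)] at hk' hcd'
  have ek : G.drgK = G'.drgK := Nat.cast_injective (R := ℂ) (hk.trans hk'.symm)
  refine ⟨ek, fun i hi => ?_⟩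
  have ebc : G.drgB i = G'.drgB i ∧ G.drgC i = G'.drgC i := by
    rcases Nat.eq_zero_or_pos i with rfl | hpos
    · exact ⟨by rw [hG.drgB_zero, hG'.drgB_zero, ek], rfl⟩
    rcases hi.lt_or_eq with hlt | rfl
    · have b1 := (hB i hpos (by omega)).2
      have b2 := (hB' i hpos (by omega)).2
      have c1 := (hC i hpos (by omega)).2
      have c2 := (hC' i hpos (by omega)).2
      rw [hall i hi, hall (i - 1) (by omega), hall (i + 1) (by omega), hall 1 (by omega)] at b2 c2
      exact ⟨Nat.cast_injective (R := ℂ) (b1.trans b2.symm),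
        Nat.cast_injective (R := ℂ) (c1.trans c2.symm)⟩
    · exact ⟨by rw [hG.drgB_diam, ← hdiam, hG'.drgB_diam],
        Nat.cast_injective (R := ℂ) (hcd.trans hcd'.symm)⟩
  refine ⟨?_, ebc⟩
  have s1 := hG.drgC_add_drgA_add_drgB hi
  have s2 := hG'.drgC_add_drgA_add_drgB (hdiam ▸ hi)
  omega

end Converse

end SimpleGraph

theorem theorem10p2 {V : Type*} [Fintype V] (G : SimpleGraph V) (d : ℕ)
    (hG : G.IsDistanceRegular) (hdiam : G.diam = d) (hd : 3 ≤ d) (hnb : ¬ G.IsBipartite) :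
    -- the equivalence
    (∀ (σ : ℕ → ℂ) (ε h : ℂ),
      (G.IsTightWith σ ε ∧
        h = ((1 - σ 1) * (1 - σ 2)) / ((σ 1 ^ 2 - σ 2) * (1 - ε * σ 1))) ↔
      (σ 0 = 1 ∧ σ (d - 1) = σ 1 * σ d ∧ ε ≠ -1 ∧
        (σ 1 - 1 ≠ 0 ∧ (G.drgK : ℂ) = h * ((σ 1 - ε) / (σ 1 - 1))) ∧
        (∀ i : ℕ, 1 ≤ i → i ≤ d - 1 →
          (σ (i - 1) - σ (i + 1)) * (σ (i + 1) - σ i) ≠ 0 ∧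
          (G.drgB i : ℂ) =
            h * (((σ (i - 1) - σ 1 * σ i) * (σ (i + 1) - ε * σ i)) /
              ((σ (i - 1) - σ (i + 1)) * (σ (i + 1) - σ i)))) ∧
        (∀ i : ℕ, 1 ≤ i → i ≤ d - 1 →
          (σ (i + 1) - σ (i - 1)) * (σ (i - 1) - σ i) ≠ 0 ∧
          (G.drgC i : ℂ) =
            h * (((σ (i + 1) - σ 1 * σ i) * (σ (i - 1) - ε * σ i)) /
              ((σ (i + 1) - σ (i - 1)) * (σ (i - 1) - σ i)))) ∧
        (σ 1 - 1 ≠ 0 ∧ (G.drgC d : ℂ) = h * ((σ 1 - ε) / (σ 1 - 1))))) ∧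
    -- the `d` scalars `σ_1, …, σ_{d-1}, ε` determine the intersection numbers of a tight graph
    (∀ (W : Type*) [Fintype W] (G' : SimpleGraph W) (σ τ : ℕ → ℂ) (ε : ℂ),
      G'.IsDistanceRegular → G'.diam = d →
      G.IsTightWith σ ε → G'.IsTightWith τ ε →
      (∀ i : ℕ, 1 ≤ i → i ≤ d - 1 → σ i = τ i) →
      G.drgK = G'.drgK ∧ ∀ i : ℕ, i ≤ d →
        G.drgA i = G'.drgA i ∧ G.drgB i = G'.drgB i ∧ G.drgC i = G'.drgC i) := by
  subst hdiam
  refine ⟨fun σ ε h => ⟨fun hσ => hσ.1.hasParametrization hG (by omega) hσ.2, fun H => ?_⟩, ?_⟩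
  · exact SimpleGraph.HasParametrization.isTightWith hG (by omega) hnb H
  · intro W _ G' σ τ ε hG' hdiam' hσ hτ hστ
    exact hσ.intersectionNumbers_eq hG hG' hd hdiam' hτ hστ
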